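/- Let $d\ge 1$, let $\mathbb T^d$ be the $d$-torus with angles $\boldsymbol\theta$ and normalized Lebesgue measure $\mu$, and let $\Lambda\subset\mathbb Z^d$ be finite with $\mathbf 0\in\Lambda$ and $-\Lambda=\Lambda$; put $\Lambda_0=\Lambda\setminus\{\mathbf 0\}$. All families of coefficients are real and symmetric ($x_{-\mathbf k}=x_{\mathbf k}$). For $\mathbf p=(p_{\mathbf k})_{\mathbf k\in\Lambda_0}$ and $\mathbf q=(q_{\mathbf k})_{\mathbf k\in\Lambda}$ let $$P=1+\sum_{\mathbf k\in\Lambda_0}p_{\mathbf k}e^{-i\langle\mathbf k,\boldsymbol\theta\rangle},\qquad Q=\sum_{\mathbf k\in\Lambda}q_{\mathbf k}e^{-i\langle\mathbf k,\boldsymbol\theta\rangle},$$ and let $\mathfrak P_{+,o}$ (resp. $\mathfrak P_+$) be the set of $\mathbf p$ (resp. $\mathbf q$) with $P>0$ (resp. $Q>0$) everywhere on $\mathbb T^d$. Let $\Gamma(\Phi)=\big(\int e^{i\langle\mathbf k,\boldsymbol\theta\rangle}\Phi\,d\mu\big)_{\mathbf k\in\Lambda}$ and let $\Gamma_0$ be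 the same with $\Lambda_0$ in place of $\Lambda$. Let $\mathscr C_+$ be the set of all $\mathbf c=\Gamma(\Phi_0)$, where $\Phi_0\ge 0$ is integrable, even in $\boldsymbol\theta$, and strictly positive on some nonempty open ball, and let $\mathscr M$ be the space of all real symmetric families $\mathbf m=(m_{\mathbf k})_{\mathbf k\in\Lambda_0}$. Fix an integer $\nu\ge\frac d2+1$. For $(\mathbf p,\mathbf q)\in\mathfrak P_{+,o}\times\mathfrak P_+$ and $\lambda>0$ put $$\mathbf f(\mathbf p,\mathbf q,\lambda)=\Big(-\Gamma\big((P/Q)^\nu\big),\ \Gamma_0\big(\tfrac{\nu}{\nu-1}(P/Q)^{\nu-1}-\lambda P^{-\nu}\big)\Big).$$ Then: 1. For each fixed $\lambda>0$, the map $\omega(\mathbf p,\mathbf q)=\mathbf f(\mathbf p,\mathbf q,\lambda)$ is a $C^\infty$ diffeomorphism of the open set $\mathfrak P_{+,o}\times\mathfrak P_+$ onto the open set $-\mathscr C_+\times\mathscr M$. 2. For each fixed $(\mathbf c,\mathbf m)\in\mathscr C_+\times\mathscr M$ and every $\lambda>0$, the equation $\mathbf f(\mathbf p,\mathbf q,\lambda)=(-\mathbf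 c,\mathbf m)$ has a unique solution $(\mathbf p_\lambda,\mathbf q_\lambda)\in\mathfrak P_{+,o}\times\mathfrak P_+$, and it is a $C^\infty$ function of $\lambda\in(0,\infty)$. 3. The regularized dual problem of minimizing $$J_{\nu,\lambda}(\mathbf p,\mathbf q)=\frac1{\nu-1}\int\frac{P^\nu}{Q^{\nu-1}}\,d\mu+\sum_{\mathbf k\in\Lambda}q_{\mathbf k}c_{\mathbf k}-\sum_{\mathbf k\in\Lambda_0}p_{\mathbf k}m_{\mathbf k}+\frac{\lambda}{\nu-1}\int\frac1{P^{\nu-1}}\,d\mu\in(-\infty,\infty]$$ over $\overline{\mathfrak P}_{+,o}\times\overline{\mathfrak P}_+$ (with $a/0=\infty$ for $a>0$ in the integrands) is well-posed in the sense of Hadamard: for all $(\mathbf c,\mathbf m)\in\mathscr C_+\times\mathscr M$ and $\lambda>0$ it has a unique solution; a point solves it if and only if it lies in $\mathfrak P_{+,o}\times\mathfrak P_+$ and satisfies $\mathbf f(\mathbf p,\mathbf q,\lambda)=(-\mathbf c,\mathbf m)$; and the solution depends continuously on $(\mathbf c,\mathbf m,\lambda)\in\mathscr C_+\times\mathscr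 M\times(0,\infty)$. -/

import Mathlib

open MeasureTheory Set
open scoped ContDiff ENNReal ComplexConjugate

namespace CepstralMoment

noncomputable section

/-- Normalized Lebesgue (Haar) measure on the `d`-torus. The torus is parametrized by `t = θ / 2π`
in `(ℝ/ℤ)^d`, so that `UnitAddTorus.mFourier k t = exp (i ⟨k, θ⟩)`. -/
def torusMeasure (d : ℕ) : Measure (UnitAddTorus (Fin d)) :=
  Measure.pi fun _ => (AddCircle.haarAddCircle : Measure UnitAddCircle)

/-- Real families `x = (x_k)_{k ∈ I}` such that `x_{-k} = x_k`. -/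
def symSeq {d : ℕ} (I : Finset (Fin d → ℤ)) : Submodule ℝ (I → ℝ) where
  carrier := {x | ∀ j k : I, (j : Fin d → ℤ) = -(k : Fin d → ℤ) → x j = x k}
  add_mem' := fun hx hy j k h => by simp [hx j k h, hy j k h]
  zero_mem' := fun _ _ _ => rfl
  smul_mem' := fun a x hx j k h => by simp [hx j k h]

/-- The trigonometric polynomial `∑_{k ∈ I} q_k exp (-i ⟨k, θ⟩)`, as a complex number. -/
def trigSum {d : ℕ} {I : Finset (Fin d → ℤ)} (q : symSeq I) (t : UnitAddTorus (Fin d)) : ℂ :=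
  ∑ k : I, ((q : I → ℝ) k : ℂ) * UnitAddTorus.mFourier (-(k : Fin d → ℤ)) t

/-- The real value of the trigonometric polynomial with symmetric coefficients `q`; for an index
set which is symmetric about the origin, see `trigSum_eq`. -/
def trigPoly {d : ℕ} {I : Finset (Fin d → ℤ)} (q : symSeq I) (t : UnitAddTorus (Fin d)) : ℝ :=
  (trigSum q t).re

theorem trigSum_eq {d : ℕ} {I : Finset (Fin d → ℤ)} (hI : ∀ k ∈ I, -k ∈ I) (q : symSeq I)
    (t : UnitAddTorus (Fin d)) : trigSum q t = (trigPoly q t : ℂ) := by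
  refine (Complex.conj_eq_iff_re.1 ?_).symm
  unfold trigSum
  rw [map_sum]
  let e : I ≃ I :=
    { toFun := fun k => ⟨-k, hI k k.2⟩
      invFun := fun k => ⟨-k, hI k k.2⟩
      left_inv := fun k => by simp
      right_inv := fun k => by simp }
  refine Fintype.sum_equiv e _ _ fun k => ?_
  rw [map_mul, Complex.conj_ofReal, ← UnitAddTorus.mFourier_neg, q.2 (e k) k rfl]
  rfl

/-- The polynomial `P` with coefficients `p_k`, `k ≠ 0`, and `p_0 = 1`. -/
def polyP {d : ℕ} {Λ : Finset (Fin d → ℤ)} (p : symSeq (Λ.erase 0)) (t : UnitAddTorus (Fin d)) :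
    ℝ :=
  1 + trigPoly p t

/-- The cone `𝔓₊` of positive symmetric trigonometric polynomials, as a set of coefficients. -/
def posPoly {d : ℕ} (Λ : Finset (Fin d → ℤ)) : Set (symSeq Λ) :=
  {q | ∀ t, 0 < trigPoly q t}

/-- The set `𝔓₊,ₒ` of positive symmetric trigonometric polynomials with `p_0 = 1`, as a set of
coefficients `(p_k)`, `k ∈ Λ \ {0}`. -/
def posPolyOne {d : ℕ} (Λ : Finset (Fin d → ℤ)) : Set (symSeq (Λ.erase 0)) :=
  {p | ∀ t, 0 < polyP p t}

/-- The Fourier coefficient `∫ exp (i ⟨k, θ⟩) Φ dμ`. -/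
def fourierMoment {d : ℕ} (Φ : UnitAddTorus (Fin d) → ℝ) (k : Fin d → ℤ) : ℂ :=
  ∫ t, UnitAddTorus.mFourier k t * (Φ t : ℂ) ∂torusMeasure d

theorem fourierMoment_neg {d : ℕ} (Φ : UnitAddTorus (Fin d) → ℝ) (k : Fin d → ℤ) :
    fourierMoment Φ (-k) = conj (fourierMoment Φ k) := by
  unfold fourierMoment
  rw [← integral_conj]
  simp only [map_mul, Complex.conj_ofReal, UnitAddTorus.mFourier_neg]

/-- The operator `Γ` that sends a function to its Fourier coefficients indexed in `I`. It is applied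
to even functions only, for which these coefficients are real: see `fourierMoment_eq`. -/
def Gam {d : ℕ} (I : Finset (Fin d → ℤ)) (Φ : UnitAddTorus (Fin d) → ℝ) : symSeq I :=
  ⟨fun k => (fourierMoment Φ k).re, fun j k h => by
    change (fourierMoment Φ j).re = (fourierMoment Φ k).re
    rw [h, fourierMoment_neg, Complex.conj_re]⟩

theorem fourierMoment_eq {d : ℕ} {I : Finset (Fin d → ℤ)} {Φ : UnitAddTorus (Fin d) → ℝ}
    (hΦ : ∀ t, Φ (-t) = Φ t) (k : I) :
    fourierMoment Φ k = ((Gam I Φ : I → ℝ) k : ℂ) := by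
  refine (Complex.conj_eq_iff_re.1 ?_).symm
  rw [← fourierMoment_neg]
  unfold fourierMoment torusMeasure
  have : (AddCircle.haarAddCircle : Measure UnitAddCircle).IsNegInvariant := inferInstance
  have : (Measure.pi fun _ : Fin d =>
      (AddCircle.haarAddCircle : Measure UnitAddCircle)).IsNegInvariant := inferInstance
  rw [← integral_neg_eq_self]
  refine integral_congr_ae (.of_forall fun t => ?_)
  simp [hΦ, UnitAddTorus.mFourier, fourier_apply]

/-- The set `𝒞₊` of covariances `Γ(Φ₀)` of nonnegative integrable even functions `Φ₀` which are
strictly positive on some open ball. -/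
def covSet {d : ℕ} (Λ : Finset (Fin d → ℤ)) : Set (symSeq Λ) :=
  {c | ∃ Φ₀ : UnitAddTorus (Fin d) → ℝ, Integrable Φ₀ (torusMeasure d) ∧ (∀ t, 0 ≤ Φ₀ t) ∧
    (∃ t₀, ∃ r > 0, ∀ t ∈ Metric.ball t₀ r, 0 < Φ₀ t) ∧ (∀ t, Φ₀ (-t) = Φ₀ t) ∧ c = Gam Λ Φ₀}

/-- The moment map `f(p, q, l) = (-Γ((P/Q)^ν), Γ₀(ν/(ν-1) (P/Q)^(ν-1) - l/P^ν))`. The set `ℳ` of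
cepstral data is the whole space `symSeq (Λ.erase 0)`. -/
def momentMap {d : ℕ} (Λ : Finset (Fin d → ℤ)) (ν : ℕ)
    (x : symSeq (Λ.erase 0) × symSeq Λ) (l : ℝ) : symSeq Λ × symSeq (Λ.erase 0) :=
  (-Gam Λ fun t => (polyP x.1 t / trigPoly x.2 t) ^ ν,
    Gam (Λ.erase 0) fun t =>
      (ν : ℝ) / ((ν : ℝ) - 1) * (polyP x.1 t / trigPoly x.2 t) ^ (ν - 1) - l / polyP x.1 t ^ ν)

/-- `f` restricts to a `C^∞` diffeomorphism of the open set `U` onto the open set `V`. -/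
def IsSmoothDiffeoOn {E F : Type*} [NormedAddCommGroup E] [NormedSpace ℝ E]
    [NormedAddCommGroup F] [NormedSpace ℝ F] (f : E → F) (U : Set E) (V : Set F) : Prop :=
  IsOpen U ∧ IsOpen V ∧ BijOn f U V ∧ ContDiffOn ℝ ∞ f U ∧
    ∃ g : F → E, InvOn g f U V ∧ ContDiffOn ℝ ∞ g V

/-- The regularized dual function
`1/(ν-1) ∫ P^ν/Q^(ν-1) dμ + ⟨q, c⟩ - ⟨p, m⟩ + l/(ν-1) ∫ 1/P^(ν-1) dμ`
with values in `(-∞, ∞]`, for nonnegative `P` and `Q`. In the integrals `a / 0 = ∞` for `a > 0`.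
The inner product `⟨p, m⟩` is taken over `Λ \ {0}`: the term with index `0` is a constant. -/
def regDual {d : ℕ} (Λ : Finset (Fin d → ℤ)) (ν : ℕ) (l : ℝ) (c : symSeq Λ)
    (m : symSeq (Λ.erase 0)) (x : symSeq (Λ.erase 0) × symSeq Λ) : EReal :=
  ((ENNReal.ofReal (1 / ((ν : ℝ) - 1)) *
      ∫⁻ t, ENNReal.ofReal (polyP x.1 t) ^ ν / ENNReal.ofReal (trigPoly x.2 t) ^ (ν - 1)
        ∂torusMeasure d +
    ENNReal.ofReal (l / ((ν : ℝ) - 1)) *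
      ∫⁻ t, 1 / ENNReal.ofReal (polyP x.1 t) ^ (ν - 1) ∂torusMeasure d : ℝ≥0∞) : EReal) +
  ((∑ k : Λ, (x.2 : Λ → ℝ) k * (c : Λ → ℝ) k -
    ∑ k : Λ.erase 0, (x.1 : Λ.erase 0 → ℝ) k * (m : Λ.erase 0 → ℝ) k : ℝ) : EReal)

/-- `x = (p, q)` solves the regularized dual problem: it minimizes the regularized dual function
over the product of the closures of `𝔓₊,ₒ` and `𝔓₊`. -/
def IsDualSolution {d : ℕ} (Λ : Finset (Fin d → ℤ)) (ν : ℕ) (l : ℝ) (c : symSeq Λ)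
    (m : symSeq (Λ.erase 0)) (x : symSeq (Λ.erase 0) × symSeq Λ) : Prop :=
  x ∈ closure (posPolyOne Λ) ×ˢ closure (posPoly Λ) ∧
    IsMinOn (regDual Λ ν l c m) (closure (posPolyOne Λ) ×ˢ closure (posPoly Λ)) x

end

end CepstralMoment

namespace CepstralMoment

open Filter Topology

noncomputable section

variable {d : ℕ}

/-! On positive polynomials the gradient of the dual function is the moment map minus the data, up
to pairing, so everything rests on the variational problem.

Existence. Coefficients of `P ≥ 0` are at most 1 in modulus because `P` has mean 1
(`abs_coeff_le_one`), and a covariance is coercive on nonnegative `Q` (`exists_coercive`). With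
lower semicontinuity from Fatou's lemma, a minimizer exists over the closures. A nonnegative
trigonometric polynomial vanishes to second order at its zeros (`exists_quadratic_bound`), so its
power `-(ν-1)` is not integrable when `2(ν-1) ≥ d`. The dual function is therefore infinite at
boundary points (`regDual_eq_top`), the minimizer is interior, and it solves the moment equations.

Uniqueness. The integrand `P^ν/Q^(ν-1)` is the perspective of a convex power, and the term in `λ`
makes the gradient strictly monotone (`gradient_monotone`). This gives injectivity of the moment
map; the infinitesimal version is injectivity of its derivative (`fderiv_extMomentMap_injective`).

Regularity. With `λ` adjoined as a coordinate of both source and target, the inverse function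
theorem gives one diffeomorphism (`isSmoothDiffeoOn_extMomentMap`). All smoothness and continuity
claims, and the openness of the target, are read off from it and its inverse. -/

instance : (torusMeasure d).IsAddHaarMeasure := by unfold torusMeasure; infer_instance

instance : IsProbabilityMeasure (torusMeasure d) := by unfold torusMeasure; infer_instance

/-! ### Characters, cosines and orthogonality. -/

/-- The function `cos ⟨k, θ⟩` on the torus. -/
def cosChar (k : Fin d → ℤ) : C(UnitAddTorus (Fin d), ℝ) where
  toFun t := (UnitAddTorus.mFourier k t).re
  continuous_toFun := by fun_prop

theorem cosChar_apply (k : Fin d → ℤ) (t : UnitAddTorus (Fin d)) :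
    cosChar k t = (UnitAddTorus.mFourier k t).re := rfl

theorem mFourier_apply_add (k : Fin d → ℤ) (s t : UnitAddTorus (Fin d)) :
    UnitAddTorus.mFourier k (s + t) = UnitAddTorus.mFourier k s * UnitAddTorus.mFourier k t := by
  simp [UnitAddTorus.mFourier, fourier_apply, AddCircle.toCircle_add, Finset.prod_mul_distrib]

theorem mFourier_apply_neg (k : Fin d → ℤ) (t : UnitAddTorus (Fin d)) :
    UnitAddTorus.mFourier k (-t) = conj (UnitAddTorus.mFourier k t) := by
  rw [← UnitAddTorus.mFourier_neg]
  simp [UnitAddTorus.mFourier, fourier_apply]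

theorem norm_mFourier_apply (k : Fin d → ℤ) (t : UnitAddTorus (Fin d)) :
    ‖UnitAddTorus.mFourier k t‖ = 1 := by
  simp [UnitAddTorus.mFourier, fourier_apply, Circle.norm_coe]

theorem cosChar_apply_neg (k : Fin d → ℤ) (t : UnitAddTorus (Fin d)) :
    cosChar k (-t) = cosChar k t := by
  simp [cosChar_apply, mFourier_apply_neg]

/-- Controls symmetric second differences, which stand in for a second-order Taylor expansion on the
torus. -/
theorem cosChar_add_sub (k : Fin d → ℤ) (s t : UnitAddTorus (Fin d)) :
    cosChar k (s + t) + cosChar k (s - t) = 2 * cosChar k s * cosChar k t := by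
  simp only [cosChar_apply, sub_eq_add_neg, mFourier_apply_add, mFourier_apply_neg,
    Complex.mul_re, Complex.conj_re, Complex.conj_im]
  ring

theorem trigPoly_eq_sum {I : Finset (Fin d → ℤ)} (q : symSeq I) (t : UnitAddTorus (Fin d)) :
    trigPoly q t = ∑ k : I, (q : I → ℝ) k * cosChar k t := by
  simp [trigPoly, trigSum, cosChar_apply, UnitAddTorus.mFourier_neg]

theorem trigPoly_apply_neg {I : Finset (Fin d → ℤ)} (q : symSeq I) (t : UnitAddTorus (Fin d)) :
    trigPoly q (-t) = trigPoly q t := by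
  simp [trigPoly_eq_sum, cosChar_apply_neg]

theorem polyP_apply_neg {Λ : Finset (Fin d → ℤ)} (p : symSeq (Λ.erase 0))
    (t : UnitAddTorus (Fin d)) : polyP p (-t) = polyP p t := by
  simp [polyP, trigPoly_apply_neg]

theorem integral_mFourier (k : Fin d → ℤ) :
    ∫ t, UnitAddTorus.mFourier k t ∂torusMeasure d = if k = 0 then 1 else 0 := by
  split_ifs with h
  · simp [h, UnitAddTorus.mFourier_zero]
  obtain ⟨i, hi⟩ := Function.ne_iff.mp h
  unfold torusMeasure
  simp only [UnitAddTorus.mFourier, ContinuousMap.coe_mk]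
  rw [integral_fintype_prod_eq_prod (fun i (t : UnitAddCircle) => fourier (k i) t)]
  apply Finset.prod_eq_zero (Finset.mem_univ i)
  exact integral_eq_zero_of_add_right_eq_neg (fourier_add_half_inv_index hi Fact.out)

theorem integrable_of_continuous {E : Type*} [NormedAddCommGroup E]
    {f : UnitAddTorus (Fin d) → E} (hf : Continuous f) : Integrable f (torusMeasure d) :=
  hf.integrable_of_hasCompactSupport (HasCompactSupport.of_compactSpace f)

theorem continuous_trigPoly {I : Finset (Fin d → ℤ)} (q : symSeq I) : Continuous (trigPoly q) := by
  simp only [funext (trigPoly_eq_sum q)]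
  fun_prop

theorem continuous_polyP {Λ : Finset (Fin d → ℤ)} (p : symSeq (Λ.erase 0)) :
    Continuous (polyP p) := continuous_const.add (continuous_trigPoly p)

theorem integral_mFourier_mul_trigPoly {I : Finset (Fin d → ℤ)} (hI : ∀ k ∈ I, -k ∈ I)
    (q : symSeq I) (j : Fin d → ℤ) :
    ∫ t, UnitAddTorus.mFourier j t * (trigPoly q t : ℂ) ∂torusMeasure d =
      if h : j ∈ I then ((q : I → ℝ) ⟨j, h⟩ : ℂ) else 0 := by
  have h1 : ∀ t, UnitAddTorus.mFourier j t * (trigPoly q t : ℂ) =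
      ∑ k : I, ((q : I → ℝ) k : ℂ) * UnitAddTorus.mFourier (j - (k : Fin d → ℤ)) t := fun t => by
    rw [← trigSum_eq hI, trigSum, Finset.mul_sum]
    refine Finset.sum_congr rfl fun k _ => ?_
    rw [sub_eq_add_neg, UnitAddTorus.mFourier_add]; ring
  simp only [h1]
  rw [integral_finsetSum _ fun k _ => integrable_of_continuous (by fun_prop)]
  simp only [integral_const_mul, integral_mFourier, sub_eq_zero]
  split_ifs with h
  · rw [Finset.sum_eq_single ⟨j, h⟩]
    · simp
    · intro b _ hb
      rw [if_neg, mul_zero]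
      rintro rfl; exact hb rfl
    · simp
  · refine Finset.sum_eq_zero fun k _ => ?_
    rw [if_neg, mul_zero]
    rintro rfl; exact h k.2

theorem eq_zero_of_trigPoly_eq_zero {I : Finset (Fin d → ℤ)} (hI : ∀ k ∈ I, -k ∈ I)
    {q : symSeq I} (hq : ∀ t, trigPoly q t = 0) : q = 0 := by
  ext k
  have := integral_mFourier_mul_trigPoly hI q k
  simp only [hq, Complex.ofReal_zero, mul_zero, integral_zero, k.2, dif_pos] at this
  exact_mod_cast this.symm

/-! ### Second-order zeros and divergent integrals. -/

/-- A chord is shorter than its arc; the representative `y - round y` realizes the norm on the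
circle. -/
theorem norm_fourier_sub_one_le (n : ℤ) (x : UnitAddCircle) :
    ‖(fourier n x : ℂ) - 1‖ ≤ 2 * Real.pi * |(n : ℝ)| * ‖x‖ := by
  obtain ⟨y, rfl⟩ := QuotientAddGroup.mk_surjective x
  have hy : ((y : ℝ) : UnitAddCircle) = ((y - round y : ℝ) : UnitAddCircle) := by
    rw [AddCircle.coe_sub]
    have : ((round y : ℝ) : UnitAddCircle) = 0 := by
      rw [AddCircle.coe_eq_zero_iff]
      exact ⟨round y, by simp⟩
    simp [this]
  change ‖(fourier n (y : UnitAddCircle) : ℂ) - 1‖ ≤ _ * ‖(y : UnitAddCircle)‖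
  rw [UnitAddCircle.norm_eq, hy, fourier_coe_apply]
  have := Real.norm_exp_I_mul_ofReal_sub_one_le (x := 2 * Real.pi * n * (y - round y))
  rw [Real.norm_eq_abs, abs_mul, abs_mul, abs_of_pos Real.two_pi_pos] at this
  convert this using 4
  push_cast
  ring

theorem norm_mFourier_sub_one_le (k : Fin d → ℤ) (h : UnitAddTorus (Fin d)) :
    ‖UnitAddTorus.mFourier k h - 1‖ ≤ (2 * Real.pi * ∑ i, |(k i : ℝ)|) * ‖h‖ := by
  have aux : ∀ s : Finset (Fin d), ‖∏ i ∈ s, (fourier (k i) (h i) : ℂ) - 1‖ ≤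
      ∑ i ∈ s, ‖(fourier (k i) (h i) : ℂ) - 1‖ := by
    intro s
    induction s using Finset.induction_on with
    | empty => simp
    | insert i s hi ih =>
      rw [Finset.prod_insert hi, Finset.sum_insert hi]
      calc _ = ‖((fourier (k i) (h i) : ℂ) - 1) * ∏ i ∈ s, (fourier (k i) (h i) : ℂ) +
            (∏ i ∈ s, (fourier (k i) (h i) : ℂ) - 1)‖ := by ring_nf
        _ ≤ _ := norm_add_le _ _
        _ ≤ _ := by
          gcongr
          simp [fourier_apply, Circle.norm_coe]
  refine (aux Finset.univ).trans ?_
  rw [mul_assoc, Finset.sum_mul, Finset.mul_sum]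
  refine Finset.sum_le_sum fun i _ => (norm_fourier_sub_one_le _ _).trans ?_
  rw [← mul_assoc]
  gcongr
  exact norm_le_pi_norm h i

/-- For unimodular `z`, `‖z - 1‖ ^ 2 = 2 * (1 - Re z)`, so the linear bound on the character becomes
quadratic for its real part. -/
theorem one_sub_cosChar_le (k : Fin d → ℤ) (h : UnitAddTorus (Fin d)) :
    1 - cosChar k h ≤ ((2 * Real.pi * ∑ i, |(k i : ℝ)|) * ‖h‖) ^ 2 / 2 := by
  have h1 := norm_mFourier_sub_one_le k h
  have h2 : ‖UnitAddTorus.mFourier k h - 1‖ ^ 2 = 2 * (1 - cosChar k h) := by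
    have h3 := norm_mFourier_apply k h
    have h4 : ‖UnitAddTorus.mFourier k h‖ ^ 2 = 1 := by rw [h3]; norm_num
    rw [← Complex.normSq_eq_norm_sq, Complex.normSq_apply] at h4 ⊢
    rw [cosChar_apply]
    simp only [Complex.sub_re, Complex.sub_im, Complex.one_re, Complex.one_im]
    linarith
  have h5 := pow_le_pow_left₀ (norm_nonneg _) h1 2
  linarith

theorem cosChar_le_one (k : Fin d → ℤ) (t : UnitAddTorus (Fin d)) : |cosChar k t| ≤ 1 :=
  (Complex.abs_re_le_norm _).trans (norm_mFourier_apply k t).le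

/-- Nonnegative trigonometric polynomials vanish to second order at their zeros. -/
theorem exists_quadratic_bound {I : Finset (Fin d → ℤ)} (q : symSeq I) (a : ℝ)
    (hpos : ∀ t, 0 ≤ a + trigPoly q t) {t₀ : UnitAddTorus (Fin d)} (h0 : a + trigPoly q t₀ = 0) :
    ∃ C : ℝ, 0 < C ∧ ∀ t, a + trigPoly q t ≤ C * ‖t - t₀‖ ^ 2 := by
  let C : ℝ := ∑ k : I, |(q : I → ℝ) k| * (2 * Real.pi * ∑ i, |((k : Fin d → ℤ) i : ℝ)|) ^ 2
  have hC : 0 ≤ C := Finset.sum_nonneg fun k _ => by positivity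
  -- The added 1 keeps the constant positive when all nonconstant coefficients vanish.
  refine ⟨C + 1, by positivity, fun t => ?_⟩
  -- Nonnegativity at the reflection of `t` in the zero `t₀` lets the second difference centred at
  -- `t₀` bound the value at `t` alone.
  have h1 := hpos (t₀ - (t - t₀))
  have h2 : trigPoly q t + trigPoly q (t₀ - (t - t₀)) - 2 * trigPoly q t₀ ≤
      C * ‖t - t₀‖ ^ 2 := by
    have ht : t = t₀ + (t - t₀) := by abel
    conv_lhs => rw [ht]
    simp only [add_sub_cancel_left]
    simp only [trigPoly_eq_sum, Finset.mul_sum, C, Finset.sum_mul, ← Finset.sum_add_distrib,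
      ← Finset.sum_sub_distrib]
    refine Finset.sum_le_sum fun k _ => ?_
    have e : (q : I → ℝ) k * cosChar k (t₀ + (t - t₀)) +
        (q : I → ℝ) k * cosChar k (t₀ - (t - t₀)) - 2 * ((q : I → ℝ) k * cosChar k t₀) =
        (-((q : I → ℝ) k * cosChar k t₀)) * (2 * (1 - cosChar k (t - t₀))) := by
      linear_combination (q : I → ℝ) k * cosChar_add_sub k t₀ (t - t₀)
    rw [e]
    have h3 := one_sub_cosChar_le (k : Fin d → ℤ) (t - t₀)
    have h4 : -((q : I → ℝ) k * cosChar k t₀) ≤ |(q : I → ℝ) k| := by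
      refine (neg_le_abs _).trans ?_
      rw [abs_mul]
      exact mul_le_of_le_one_right (abs_nonneg _) (cosChar_le_one _ _)
    have h5 : 0 ≤ 1 - cosChar k (t - t₀) := by
      linarith [(abs_le.1 (cosChar_le_one (k : Fin d → ℤ) (t - t₀))).2]
    calc _ ≤ |(q : I → ℝ) k| * (2 * (1 - cosChar k (t - t₀))) := by gcongr
      _ ≤ |(q : I → ℝ) k| * (2 * (((2 * Real.pi * ∑ i, |((k : Fin d → ℤ) i : ℝ)|) *
          ‖t - t₀‖) ^ 2 / 2)) := by gcongr
      _ = _ := by rw [← Finset.mul_sum]; ring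
  nlinarith [sq_nonneg ‖t - t₀‖]

theorem haarAddCircle_eq_volume :
    (AddCircle.haarAddCircle : Measure UnitAddCircle) = volume := by
  rw [AddCircle.volume_eq_smul_haarAddCircle]; simp

/-- In the sup metric a ball is a product of arcs, each of measure `min 1 (2r)`. -/
theorem le_torusMeasure_closedBall (t₀ : UnitAddTorus (Fin d)) {r : ℝ} (hr : 0 < r)
    (hr1 : r ≤ 1) : ENNReal.ofReal (r ^ d) ≤ torusMeasure d (Metric.closedBall t₀ r) := by
  rw [closedBall_pi _ hr.le, torusMeasure, Measure.pi_pi, ENNReal.ofReal_pow hr.le]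
  have hc : ENNReal.ofReal r ^ d = ∏ _i : Fin d, ENNReal.ofReal r := by simp
  rw [hc]
  refine Finset.prod_le_prod' fun i _ => ?_
  rw [haarAddCircle_eq_volume, AddCircle.volume_closedBall]
  exact ENNReal.ofReal_le_ofReal (le_min hr1 (by linarith))

/-- A function bounded by a quadratic at a zero has non-integrable negative powers. -/
theorem lintegral_inv_pow_eq_top {F : UnitAddTorus (Fin d) → ℝ} {t₀ : UnitAddTorus (Fin d)}
    {C : ℝ} (hC : 0 < C) (hF : ∀ t, F t ≤ C * ‖t - t₀‖ ^ 2) (hd : 0 < d) {n : ℕ}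
    (hn : d ≤ 2 * n) :
    ∫⁻ t, (ENNReal.ofReal (F t) ^ n)⁻¹ ∂torusMeasure d = ⊤ := by
  -- If the integral were finite, its restrictions to balls shrinking to `t₀` would tend to 0. But
  -- on radius `r` the integrand is at least `(C r²)⁻ⁿ` and the measure at least `r^d`, so `d ≤ 2n`
  -- and `r ≤ 1` keep them above `C⁻ⁿ`.
  by_contra hfin
  have hmeas : Tendsto (fun j : ℕ => torusMeasure d (Metric.closedBall t₀ (1 / ((j : ℝ) + 1))))
      atTop (𝓝 0) := by
    have h1 := tendsto_measure_iInter_atTop (μ := torusMeasure d)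
      (s := fun j : ℕ => Metric.closedBall t₀ (1 / ((j : ℝ) + 1)))
      (fun j => measurableSet_closedBall.nullMeasurableSet)
      (fun i j hij => Metric.closedBall_subset_closedBall (by gcongr))
      ⟨0, measure_ne_top _ _⟩
    have h2 : ⋂ j : ℕ, Metric.closedBall t₀ (1 / ((j : ℝ) + 1)) = {t₀} := by
      ext t
      simp only [mem_iInter, Metric.mem_closedBall, mem_singleton_iff]
      refine ⟨fun h => ?_, fun h j => by rw [h, dist_self]; positivity⟩
      exact dist_le_zero.1 (ge_of_tendsto' tendsto_one_div_add_atTop_nhds_zero_nat h)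
    -- For `d = 0` the torus is a point of mass 1, hence the need for `0 < d`.
    have h3 : torusMeasure d {t₀} = 0 := by
      rw [← univ_pi_singleton, torusMeasure, Measure.pi_pi]
      refine Finset.prod_eq_zero (Finset.mem_univ ⟨0, hd⟩) ?_
      rw [haarAddCircle_eq_volume, ← Metric.closedBall_zero, AddCircle.volume_closedBall]
      simp
    rwa [h2, h3] at h1
  have hlim := tendsto_setLIntegral_zero hfin hmeas
  have hlow : ∀ j : ℕ, ENNReal.ofReal ((C ^ n)⁻¹) ≤
      ∫⁻ t in Metric.closedBall t₀ (1 / ((j : ℝ) + 1)), (ENNReal.ofReal (F t) ^ n)⁻¹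
        ∂torusMeasure d := by
    intro j
    set r : ℝ := 1 / ((j : ℝ) + 1) with hr
    have hr0 : 0 < r := by positivity
    have hr1 : r ≤ 1 := by
      rw [hr, div_le_one (by positivity)]
      linarith [(Nat.cast_nonneg j : (0 : ℝ) ≤ j)]
    calc ENNReal.ofReal ((C ^ n)⁻¹) ≤ ENNReal.ofReal (((C * r ^ 2) ^ n)⁻¹ * r ^ d) := by
          apply ENNReal.ofReal_le_ofReal
          rw [mul_pow, mul_inv, mul_assoc]
          refine le_mul_of_one_le_right (by positivity) ?_
          rw [← pow_mul, ← div_eq_inv_mul, one_le_div (by positivity)]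
          exact pow_le_pow_of_le_one hr0.le hr1 hn
      _ = ENNReal.ofReal (((C * r ^ 2) ^ n)⁻¹) * ENNReal.ofReal (r ^ d) :=
          ENNReal.ofReal_mul (by positivity)
      _ ≤ ENNReal.ofReal (((C * r ^ 2) ^ n)⁻¹) * torusMeasure d (Metric.closedBall t₀ r) := by
          gcongr
          exact le_torusMeasure_closedBall t₀ hr0 hr1
      _ = ∫⁻ _ in Metric.closedBall t₀ r, ENNReal.ofReal (((C * r ^ 2) ^ n)⁻¹)
            ∂torusMeasure d := by rw [setLIntegral_const]
      _ ≤ _ := by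
          refine setLIntegral_mono' measurableSet_closedBall fun t ht => ?_
          rw [ENNReal.ofReal_inv_of_pos (by positivity), ENNReal.ofReal_pow (by positivity)]
          gcongr
          refine (hF t).trans ?_
          rw [mem_closedBall_iff_norm] at ht
          gcongr
  have := ge_of_tendsto' hlim hlow
  rw [nonpos_iff_eq_zero, ENNReal.ofReal_eq_zero] at this
  exact absurd this (not_le.2 (by positivity))

/-- A trigonometric polynomial that vanishes on a nonempty open set vanishes everywhere. -/
theorem trigPoly_eq_zero_of_isOpen {I : Finset (Fin d → ℤ)} {q : symSeq I}
    {s : Set (UnitAddTorus (Fin d))} (hs : IsOpen s) (hne : s.Nonempty)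
    (hq : ∀ t ∈ s, trigPoly q t = 0) (t : UnitAddTorus (Fin d)) : trigPoly q t = 0 := by
  -- Lifted to the universal cover, the polynomial is real analytic on a connected space, so the
  -- identity theorem applies.
  let π : (Fin d → ℝ) → UnitAddTorus (Fin d) := fun x i => (x i : UnitAddCircle)
  have hπ : Continuous π := continuous_pi fun i =>
    (AddCircle.continuous_mk' 1).comp (continuous_apply i)
  have hsurj : Function.Surjective π := fun t => by
    choose x hx using fun i => QuotientAddGroup.mk_surjective (t i)
    exact ⟨x, funext hx⟩
  have hana : AnalyticOnNhd ℝ (fun x => trigPoly q (π x)) univ := by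
    simp only [trigPoly_eq_sum]
    refine Finset.analyticOnNhd_fun_sum _ fun k _ => analyticOnNhd_const.mul ?_
    have h1 : AnalyticOnNhd ℝ (fun x : Fin d → ℝ => ∏ i,
        Complex.exp (2 * Real.pi * Complex.I * ((k : Fin d → ℤ) i) * (x i : ℂ))) univ := by
      refine Finset.analyticOnNhd_fun_prod _ fun i _ => ?_
      have h2 : AnalyticOnNhd ℝ (fun x : Fin d → ℝ => ((x i : ℝ) : ℂ)) univ :=
        (Complex.ofRealCLM.comp
          (ContinuousLinearMap.proj (R := ℝ) (φ := fun _ : Fin d => ℝ) i)).analyticOnNhd univ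
      have h3 : AnalyticOnNhd ℝ Complex.exp univ := fun z _ =>
        (analyticAt_cexp (z := z)).restrictScalars
      exact h3.comp (analyticOnNhd_const.mul h2) (mapsTo_univ _ _)
    have h4 := (Complex.reCLM.analyticOnNhd univ).comp h1 (mapsTo_univ _ _)
    refine h4.congr isOpen_univ fun x _ => ?_
    simp only [cosChar_apply, UnitAddTorus.mFourier, π, fourier_coe_apply, ContinuousMap.coe_mk,
      Function.comp_apply, Complex.reCLM_apply, Complex.ofReal_one, div_one]
  obtain ⟨t₁, ht₁⟩ := hne
  obtain ⟨x₁, rfl⟩ := hsurj t₁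
  have hzero : (fun x => trigPoly q (π x)) =ᶠ[𝓝 x₁] 0 := by
    filter_upwards [(hs.preimage hπ).mem_nhds ht₁] with x hx
    exact hq _ hx
  obtain ⟨x, rfl⟩ := hsurj t
  exact hana.eqOn_zero_of_preconnected_of_eventuallyEq_zero isPreconnected_univ (mem_univ _)
    hzero (mem_univ x)

/-! ### Pairings, and the coefficient maps as continuous linear maps. -/

theorem Gam_apply (I : Finset (Fin d → ℤ)) {Φ : UnitAddTorus (Fin d) → ℝ}
    (hΦ : Integrable Φ (torusMeasure d)) (k : I) :
    (Gam I Φ : I → ℝ) k = ∫ t, cosChar k t * Φ t ∂torusMeasure d := by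
  have hint : Integrable (fun t => UnitAddTorus.mFourier (k : Fin d → ℤ) t * (Φ t : ℂ))
      (torusMeasure d) := by
    refine (hΦ.ofReal (𝕜 := ℂ)).bdd_mul (c := 1) ?_ ?_
    · exact (map_continuous _).aestronglyMeasurable
    · exact .of_forall fun t => (norm_mFourier_apply _ t).le
  change (fourierMoment Φ k).re = _
  rw [fourierMoment, ← RCLike.re_eq_complex_re, ← integral_re hint]
  refine integral_congr_ae (.of_forall fun t => ?_)
  simp [cosChar_apply]

theorem integrable_cosChar_mul {Φ : UnitAddTorus (Fin d) → ℝ}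
    (hΦ : Integrable Φ (torusMeasure d)) (k : Fin d → ℤ) :
    Integrable (fun t => cosChar k t * Φ t) (torusMeasure d) :=
  hΦ.bdd_mul (c := 1) (map_continuous _).aestronglyMeasurable
    (.of_forall fun t => cosChar_le_one k t)

/-- The pairing of coefficients is the integral of the product of the functions. -/
theorem sum_mul_Gam {I : Finset (Fin d → ℤ)} (q : symSeq I) {Φ : UnitAddTorus (Fin d) → ℝ}
    (hΦ : Integrable Φ (torusMeasure d)) :
    ∑ k : I, (q : I → ℝ) k * (Gam I Φ : I → ℝ) k = ∫ t, trigPoly q t * Φ t ∂torusMeasure d := by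
  simp only [trigPoly_eq_sum, Finset.sum_mul, Gam_apply I hΦ, mul_assoc]
  rw [integral_finsetSum _ fun k _ => (integrable_cosChar_mul hΦ _).const_mul _]
  simp only [integral_const_mul]

/-- Trigonometric polynomials as continuous functions. -/
def polyCLM (I : Finset (Fin d → ℤ)) : symSeq I →L[ℝ] C(UnitAddTorus (Fin d), ℝ) :=
  LinearMap.toContinuousLinearMap
    { toFun := fun q => ∑ k : I, (q : I → ℝ) k • cosChar (k : Fin d → ℤ)
      map_add' := fun x y => by simp [add_smul, Finset.sum_add_distrib]
      map_smul' := fun a x => by simp [Finset.smul_sum, smul_smul] }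

theorem polyCLM_apply {I : Finset (Fin d → ℤ)} (q : symSeq I) (t : UnitAddTorus (Fin d)) :
    polyCLM I q t = trigPoly q t := by
  rw [trigPoly_eq_sum]
  simp [polyCLM, ContinuousMap.sum_apply]

theorem trigPoly_add {I : Finset (Fin d → ℤ)} (p q : symSeq I) (t : UnitAddTorus (Fin d)) :
    trigPoly (p + q) t = trigPoly p t + trigPoly q t := by
  simp [← polyCLM_apply]

theorem trigPoly_sub {I : Finset (Fin d → ℤ)} (p q : symSeq I) (t : UnitAddTorus (Fin d)) :
    trigPoly (p - q) t = trigPoly p t - trigPoly q t := by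
  simp [← polyCLM_apply]

theorem trigPoly_smul {I : Finset (Fin d → ℤ)} (a : ℝ) (q : symSeq I)
    (t : UnitAddTorus (Fin d)) : trigPoly (a • q) t = a * trigPoly q t := by
  simp [← polyCLM_apply]

theorem continuous_trigPoly_left {I : Finset (Fin d → ℤ)} (t : UnitAddTorus (Fin d)) :
    Continuous fun q : symSeq I => trigPoly q t := by
  simp only [← polyCLM_apply]
  exact (ContinuousEvalConst.continuous_eval_const t).comp (polyCLM I).continuous

theorem continuous_polyP_left {Λ : Finset (Fin d → ℤ)} (t : UnitAddTorus (Fin d)) :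
    Continuous fun p : symSeq (Λ.erase 0) => polyP p t :=
  continuous_const.add (continuous_trigPoly_left t)

/-- Integration of continuous functions on the torus. -/
def integralCLM (d : ℕ) : C(UnitAddTorus (Fin d), ℝ) →L[ℝ] ℝ :=
  LinearMap.mkContinuous
    { toFun := fun f => ∫ t, f t ∂torusMeasure d
      map_add' := fun f g => integral_add (integrable_of_continuous (map_continuous f))
        (integrable_of_continuous (map_continuous g))
      map_smul' := fun a f => integral_const_mul a _ } 1 fun f => by
    refine (norm_integral_le_of_norm_le_const (.of_forall fun t => f.norm_coe_le_norm t)).trans ?_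
    simp

theorem integralCLM_apply (f : C(UnitAddTorus (Fin d), ℝ)) :
    integralCLM d f = ∫ t, f t ∂torusMeasure d := rfl

theorem Gam_apply_continuousMap (I : Finset (Fin d → ℤ)) (f : C(UnitAddTorus (Fin d), ℝ)) (k : I) :
    (Gam I f : I → ℝ) k = integralCLM d (cosChar k * f) := by
  rw [Gam_apply I (integrable_of_continuous (map_continuous f))]
  rfl

/-- The operator `Γ` on continuous functions. -/
def gamCLM (I : Finset (Fin d → ℤ)) : C(UnitAddTorus (Fin d), ℝ) →L[ℝ] symSeq I where
  toFun f := Gam I f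
  map_add' f g := by
    ext k
    change (Gam I ⇑(f + g) : I → ℝ) k = (Gam I f : I → ℝ) k + (Gam I g : I → ℝ) k
    simp only [Gam_apply_continuousMap, mul_add, map_add]
  map_smul' a f := by
    ext k
    change (Gam I ⇑(a • f) : I → ℝ) k = a • (Gam I f : I → ℝ) k
    simp only [Gam_apply_continuousMap, mul_smul_comm, map_smul]
  cont := by
    refine Continuous.subtype_mk (continuous_pi fun k => ?_) _
    refine Continuous.congr (f := fun f => integralCLM d (cosChar k * f)) (by fun_prop) fun f => ?_
    exact (Gam_apply_continuousMap I f k).symm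

theorem gamCLM_apply (I : Finset (Fin d → ℤ)) (f : C(UnitAddTorus (Fin d), ℝ)) :
    gamCLM I f = Gam I f := rfl

theorem sum_mul_gamCLM {I : Finset (Fin d → ℤ)} (q : symSeq I) (f : C(UnitAddTorus (Fin d), ℝ)) :
    ∑ k : I, (q : I → ℝ) k * (gamCLM I f : I → ℝ) k =
      ∫ t, trigPoly q t * f t ∂torusMeasure d :=
  sum_mul_Gam q (integrable_of_continuous (map_continuous f))

/-! ### Open cones and smoothness of the moment map. -/

theorem isOpen_posPoly (Λ : Finset (Fin d → ℤ)) : IsOpen (posPoly Λ) := by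
  have h := (ContinuousMap.isOpen_setOfPred_mapsTo (X := UnitAddTorus (Fin d)) isCompact_univ
    (isOpen_Ioi (a := (0 : ℝ)))).preimage (polyCLM Λ).continuous
  convert! h using 1
  ext q
  simp [posPoly, MapsTo, polyCLM_apply]

theorem isOpen_posPolyOne (Λ : Finset (Fin d → ℤ)) : IsOpen (posPolyOne Λ) := by
  have h := (ContinuousMap.isOpen_setOfPred_mapsTo (X := UnitAddTorus (Fin d)) isCompact_univ
    (isOpen_Ioi (a := (0 : ℝ)))).preimage
      (f := fun p => 1 + polyCLM (Λ.erase 0) p) (by fun_prop)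
  convert! h using 1
  ext q
  simp [posPolyOne, MapsTo, polyCLM_apply, polyP]

theorem ringInverse_apply {f : C(UnitAddTorus (Fin d), ℝ)} (hf : ∀ t, 0 < f t)
    (t : UnitAddTorus (Fin d)) : Ring.inverse f t = (f t)⁻¹ := by
  have hu : IsUnit f := (ContinuousMap.isUnit_iff_forall_ne_zero f).2 fun t => (hf t).ne'
  have h := congrArg (fun g : C(UnitAddTorus (Fin d), ℝ) => g t) (Ring.mul_inverse_cancel f hu)
  exact eq_inv_of_mul_eq_one_right h

/-- Inversion is smooth at units of the Banach algebra of continuous functions. Since integration is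
continuous linear there, no differentiation under the integral sign is needed. -/
theorem contDiffAt_ringInverse_of_pos {f : C(UnitAddTorus (Fin d), ℝ)} (hf : ∀ t, 0 < f t) :
    ContDiffAt ℝ ∞ Ring.inverse f := by
  have hu : IsUnit f := (ContinuousMap.isUnit_iff_forall_ne_zero f).2 fun t => (hf t).ne'
  obtain ⟨u, rfl⟩ := hu
  exact contDiffAt_ringInverse ℝ u

section Models

variable (Λ : Finset (Fin d → ℤ)) (ν : ℕ)

/-- The polynomial `P` as a continuous function. -/
def polyPMap (x : symSeq (Λ.erase 0) × symSeq Λ) : C(UnitAddTorus (Fin d), ℝ) :=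
  1 + polyCLM (Λ.erase 0) x.1

/-- The function `P / Q`, for positive `Q`. -/
def ratioMap (x : symSeq (Λ.erase 0) × symSeq Λ) : C(UnitAddTorus (Fin d), ℝ) :=
  polyPMap Λ x * Ring.inverse (polyCLM Λ x.2)

/-- The function `ν/(ν-1) (P/Q)^(ν-1) - l/P^ν`, for positive `P` and `Q`. -/
def cepstralMap (z : (symSeq (Λ.erase 0) × symSeq Λ) × ℝ) : C(UnitAddTorus (Fin d), ℝ) :=
  ((ν : ℝ) / ((ν : ℝ) - 1)) • ratioMap Λ z.1 ^ (ν - 1) -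
    z.2 • Ring.inverse (polyPMap Λ z.1) ^ ν

/-- The integrand of the regularized dual function, for positive `P` and `Q`. -/
def energyMap (l : ℝ) (x : symSeq (Λ.erase 0) × symSeq Λ) : C(UnitAddTorus (Fin d), ℝ) :=
  (1 / ((ν : ℝ) - 1)) • (polyPMap Λ x ^ ν * Ring.inverse (polyCLM Λ x.2) ^ (ν - 1)) +
    (l / ((ν : ℝ) - 1)) • Ring.inverse (polyPMap Λ x) ^ (ν - 1)

variable {Λ}

theorem polyPMap_apply (x : symSeq (Λ.erase 0) × symSeq Λ) (t : UnitAddTorus (Fin d)) :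
    polyPMap Λ x t = polyP x.1 t := by
  simp [polyPMap, polyCLM_apply, polyP]

variable {x : symSeq (Λ.erase 0) × symSeq Λ}

theorem polyPMap_pos (hx : x ∈ posPolyOne Λ ×ˢ posPoly Λ)
    (t : UnitAddTorus (Fin d)) : 0 < polyPMap Λ x t := by
  rw [polyPMap_apply]; exact hx.1 t

theorem polyCLM_pos (hx : x ∈ posPolyOne Λ ×ˢ posPoly Λ)
    (t : UnitAddTorus (Fin d)) : 0 < polyCLM Λ x.2 t := by
  rw [polyCLM_apply]; exact hx.2 t

theorem ratioMap_apply (hx : x ∈ posPolyOne Λ ×ˢ posPoly Λ)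
    (t : UnitAddTorus (Fin d)) :
    ratioMap Λ x t = polyP x.1 t / trigPoly x.2 t := by
  rw [ratioMap, ContinuousMap.mul_apply, ringInverse_apply (polyCLM_pos hx), polyPMap_apply,
    polyCLM_apply, div_eq_mul_inv]

theorem cepstralMap_apply (hx : x ∈ posPolyOne Λ ×ˢ posPoly Λ)
    (l : ℝ) (t : UnitAddTorus (Fin d)) :
    cepstralMap Λ ν (x, l) t = (ν : ℝ) / ((ν : ℝ) - 1) *
      (polyP x.1 t / trigPoly x.2 t) ^ (ν - 1) - l / polyP x.1 t ^ ν := by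
  simp only [cepstralMap, ContinuousMap.sub_apply, ContinuousMap.smul_apply,
    ContinuousMap.pow_apply, ratioMap_apply hx, ringInverse_apply (polyPMap_pos hx),
    polyPMap_apply, smul_eq_mul, inv_pow, div_eq_mul_inv]

theorem energyMap_apply (hx : x ∈ posPolyOne Λ ×ˢ posPoly Λ)
    (l : ℝ) (t : UnitAddTorus (Fin d)) :
    energyMap Λ ν l x t = 1 / ((ν : ℝ) - 1) * (polyP x.1 t ^ ν / trigPoly x.2 t ^ (ν - 1)) +
      l / ((ν : ℝ) - 1) * (1 / polyP x.1 t ^ (ν - 1)) := by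
  simp only [energyMap, ContinuousMap.add_apply, ContinuousMap.smul_apply, ContinuousMap.mul_apply,
    ContinuousMap.pow_apply, ringInverse_apply (polyPMap_pos hx),
    ringInverse_apply (polyCLM_pos hx), polyCLM_apply,
    polyPMap_apply, smul_eq_mul, inv_pow, div_eq_mul_inv, one_mul]

theorem momentMap_eq (hx : x ∈ posPolyOne Λ ×ˢ posPoly Λ)
    (l : ℝ) :
    momentMap Λ ν x l =
      (-gamCLM Λ (ratioMap Λ x ^ ν), gamCLM (Λ.erase 0) (cepstralMap Λ ν (x, l))) := by
  have h1 : (fun t => (polyP x.1 t / trigPoly x.2 t) ^ ν) = ⇑(ratioMap Λ x ^ ν) := by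
    ext t; rw [ContinuousMap.pow_apply, ratioMap_apply hx]
  have h2 := funext (cepstralMap_apply ν hx l)
  rw [momentMap, h1, ← h2, gamCLM_apply, gamCLM_apply]

theorem contDiffAt_inverse_polyP (hx : x ∈ posPolyOne Λ ×ˢ posPoly Λ)
    :
    ContDiffAt ℝ ∞ (fun x : symSeq (Λ.erase 0) × symSeq Λ => Ring.inverse (polyPMap Λ x)) x := by
  refine ContDiffAt.comp x (contDiffAt_ringInverse_of_pos (polyPMap_pos hx)) ?_
  unfold polyPMap
  fun_prop

theorem contDiffAt_inverse_polyCLM (hx : x ∈ posPolyOne Λ ×ˢ posPoly Λ)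
    :
    ContDiffAt ℝ ∞ (fun x : symSeq (Λ.erase 0) × symSeq Λ => Ring.inverse (polyCLM Λ x.2)) x :=
  ContDiffAt.comp x (contDiffAt_ringInverse_of_pos (polyCLM_pos hx)) (by fun_prop)

theorem contDiffAt_ratioMap (hx : x ∈ posPolyOne Λ ×ˢ posPoly Λ)
    : ContDiffAt ℝ ∞ (ratioMap Λ) x := by
  refine ContDiffAt.mul ?_ (contDiffAt_inverse_polyCLM hx)
  unfold polyPMap
  fun_prop

theorem contDiffAt_cepstralMap (hx : x ∈ posPolyOne Λ ×ˢ posPoly Λ)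
    (l : ℝ) : ContDiffAt ℝ ∞ (cepstralMap Λ ν) (x, l) := by
  have h1 : ContDiffAt ℝ ∞ (fun z : (symSeq (Λ.erase 0) × symSeq Λ) × ℝ => ratioMap Λ z.1) (x, l) :=
    ContDiffAt.comp (x, l) (g := ratioMap Λ) (contDiffAt_ratioMap hx) contDiffAt_fst
  have h2 : ContDiffAt ℝ ∞ (fun z : (symSeq (Λ.erase 0) × symSeq Λ) × ℝ =>
      Ring.inverse (polyPMap Λ z.1)) (x, l) :=
    ContDiffAt.comp (x, l) (g := fun x => Ring.inverse (polyPMap Λ x))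
      (contDiffAt_inverse_polyP hx) contDiffAt_fst
  exact ((h1.pow _).const_smul _).sub (contDiffAt_snd.smul (h2.pow _))

theorem contDiffAt_energyMap (hx : x ∈ posPolyOne Λ ×ˢ posPoly Λ)
    (l : ℝ) : ContDiffAt ℝ ∞ (energyMap Λ ν l) x := by
  have h1 : ContDiffAt ℝ ∞ (polyPMap Λ) x := by unfold polyPMap; fun_prop
  exact (((h1.pow _).mul ((contDiffAt_inverse_polyCLM hx).pow _)).const_smul _).add
    (((contDiffAt_inverse_polyP hx).pow _).const_smul _)

end Models

theorem isOpen_posPoly_prod (Λ : Finset (Fin d → ℤ)) : IsOpen (posPolyOne Λ ×ˢ posPoly Λ) :=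
  (isOpen_posPolyOne Λ).prod (isOpen_posPoly Λ)

/-- The moment map together with the regularization parameter. -/
def extMomentMap (Λ : Finset (Fin d → ℤ)) (ν : ℕ) (z : (symSeq (Λ.erase 0) × symSeq Λ) × ℝ) :
    (symSeq Λ × symSeq (Λ.erase 0)) × ℝ :=
  (momentMap Λ ν z.1 z.2, z.2)

theorem extMomentMap_eventuallyEq {Λ : Finset (Fin d → ℤ)} (ν : ℕ)
    {x : symSeq (Λ.erase 0) × symSeq Λ} (hx : x ∈ posPolyOne Λ ×ˢ posPoly Λ) (l : ℝ) :
    extMomentMap Λ ν =ᶠ[𝓝 (x, l)] fun z => ((-gamCLM Λ (ratioMap Λ z.1 ^ ν),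
      gamCLM (Λ.erase 0) (cepstralMap Λ ν z)), z.2) := by
  have : ∀ᶠ z : (symSeq (Λ.erase 0) × symSeq Λ) × ℝ in 𝓝 (x, l), z.1 ∈ posPolyOne Λ ×ˢ posPoly Λ :=
    continuousAt_fst.eventually ((isOpen_posPoly_prod Λ).mem_nhds hx)
  filter_upwards [this] with z hz
  rw [extMomentMap, momentMap_eq ν hz]

theorem contDiffAt_extMomentMap {Λ : Finset (Fin d → ℤ)} (ν : ℕ)
    {x : symSeq (Λ.erase 0) × symSeq Λ} (hx : x ∈ posPolyOne Λ ×ˢ posPoly Λ) (l : ℝ) :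
    ContDiffAt ℝ ∞ (extMomentMap Λ ν) (x, l) := by
  refine ContDiffAt.congr_of_eventuallyEq ?_ (extMomentMap_eventuallyEq ν hx l)
  have h1 : ContDiffAt ℝ ∞ (fun z : (symSeq (Λ.erase 0) × symSeq Λ) × ℝ => ratioMap Λ z.1) (x, l) :=
    ContDiffAt.comp (x, l) (g := ratioMap Λ) (contDiffAt_ratioMap hx) contDiffAt_fst
  exact (((gamCLM Λ).contDiff.contDiffAt.comp (x, l) (h1.pow _)).neg.prodMk
    ((gamCLM _).contDiff.contDiffAt.comp (x, l) (contDiffAt_cepstralMap ν hx l))).prodMk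
    contDiffAt_snd

/-! ### Derivatives along lines and nondegeneracy of the differential. -/

theorem hasDerivAt_ratio_pow (a a' : ℝ) {b : ℝ} (hb : b ≠ 0) (b' : ℝ) (n : ℕ) :
    HasDerivAt (fun τ : ℝ => ((a + τ * a') / (b + τ * b')) ^ (n + 1))
      ((n + 1) * (a / b) ^ n * ((a' - a / b * b') / b)) 0 := by
  have h1 : HasDerivAt (fun τ : ℝ => a + τ * a') a' 0 := by
    simpa using ((hasDerivAt_id (0 : ℝ)).mul_const a').const_add a
  have h2 : HasDerivAt (fun τ : ℝ => b + τ * b') b' 0 := by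
    simpa using ((hasDerivAt_id (0 : ℝ)).mul_const b').const_add b
  have h3 := (h1.fun_div h2 (by simpa using hb)).fun_pow (n + 1)
  refine h3.congr_deriv ?_
  simp only [zero_mul, add_zero, add_tsub_cancel_right]
  push_cast
  field_simp

theorem hasDerivAt_inv_pow {a : ℝ} (ha : a ≠ 0) (a' l : ℝ) (n : ℕ) :
    HasDerivAt (fun τ : ℝ => l / (a + τ * a') ^ n) (-(l * n * a') / a ^ (n + 1)) 0 := by
  have h1 : HasDerivAt (fun τ : ℝ => a + τ * a') a' 0 := by
    simpa using ((hasDerivAt_id (0 : ℝ)).mul_const a').const_add a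
  have h3 := (hasDerivAt_const (0 : ℝ) l).fun_div (h1.fun_pow n) (by simpa using pow_ne_zero n ha)
  refine h3.congr_deriv ?_
  simp only [zero_mul, add_zero]
  rcases n with _ | n
  · simp
  · simp only [add_tsub_cancel_right]
    push_cast
    field_simp
    ring

theorem hasDerivAt_cepstral {a b : ℝ} (ha : a ≠ 0) (hb : b ≠ 0) (a' b' l : ℝ) (n : ℕ) :
    HasDerivAt (fun τ : ℝ => (n + 2 : ℝ) / (n + 1) * ((a + τ * a') / (b + τ * b')) ^ (n + 1) -
        l / (a + τ * a') ^ (n + 2))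
      ((n + 2) * (a / b) ^ n * ((a' - a / b * b') / b) + l * (n + 2) * a' / a ^ (n + 3)) 0 := by
  have h := ((hasDerivAt_ratio_pow a a' hb b' n).const_mul ((n + 2 : ℝ) / (n + 1))).sub
    (hasDerivAt_inv_pow ha a' l (n + 2))
  refine h.congr_deriv ?_
  have hn : (n + 1 : ℝ) ≠ 0 := by positivity
  push_cast
  field_simp
  ring

/-- The coefficients of `a'` and `b'` are the two integrands of the moment map, which is why
critical points of the dual function solve the moment equations. -/
theorem hasDerivAt_energy {a b : ℝ} (ha : a ≠ 0) (hb : b ≠ 0) (a' b' l : ℝ) (n : ℕ) :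
    HasDerivAt (fun τ : ℝ => 1 / (n + 1 : ℝ) * ((a + τ * a') ^ (n + 2) / (b + τ * b') ^ (n + 1)) +
        l / (n + 1) * (1 / (a + τ * a') ^ (n + 1)))
      (a' * ((n + 2 : ℝ) / (n + 1) * (a / b) ^ (n + 1) - l / a ^ (n + 2)) -
        b' * (a / b) ^ (n + 2)) 0 := by
  have h1 : HasDerivAt (fun τ : ℝ => a + τ * a') a' 0 := by
    simpa using ((hasDerivAt_id (0 : ℝ)).mul_const a').const_add a
  have h2 : HasDerivAt (fun τ : ℝ => b + τ * b') b' 0 := by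
    simpa using ((hasDerivAt_id (0 : ℝ)).mul_const b').const_add b
  have h3 := (((h1.fun_pow (n + 2)).fun_div (h2.fun_pow (n + 1))
    (by simpa using pow_ne_zero (n + 1) hb)).const_mul (1 / (n + 1 : ℝ))).fun_add
    ((hasDerivAt_inv_pow ha a' 1 (n + 1)).const_mul (l / (n + 1)))
  refine h3.congr_deriv ?_
  have hn : (n + 1 : ℝ) ≠ 0 := by positivity
  simp only [zero_mul, add_zero, add_tsub_cancel_right, show n + 2 - 1 = n + 1 from rfl, div_pow]
  push_cast
  field_simp
  ring

/-- The derivative of a map into the continuous functions is computed pointwise along lines. -/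
theorem hasFDerivAt_apply_eq {E : Type*} [NormedAddCommGroup E] [NormedSpace ℝ E]
    {F : E → C(UnitAddTorus (Fin d), ℝ)} {F' : E →L[ℝ] C(UnitAddTorus (Fin d), ℝ)} {z : E}
    (hF : HasFDerivAt F F' z) (w : E) {t : UnitAddTorus (Fin d)} {g : ℝ → ℝ} {a : ℝ}
    (hg : HasDerivAt g a 0) (hFg : ∀ᶠ τ : ℝ in 𝓝 0, F (z + τ • w) t = g τ) : F' w t = a := by
  have h1 : HasDerivAt (fun τ : ℝ => z + τ • w) w 0 := by
    simpa using ((hasDerivAt_id (0 : ℝ)).smul_const w).const_add z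
  have h2 : HasDerivAt (fun τ : ℝ => F (z + τ • w)) (F' w) 0 :=
    HasFDerivAt.comp_hasDerivAt (0 : ℝ) (by simpa using hF) h1
  have h3 := (ContinuousMap.evalCLM ℝ t).hasFDerivAt.comp_hasDerivAt (0 : ℝ) h2
  exact h3.unique (hg.congr_of_eventuallyEq hFg)

theorem eventually_mem_line {Λ : Finset (Fin d → ℤ)} {x : symSeq (Λ.erase 0) × symSeq Λ}
    (hx : x ∈ posPolyOne Λ ×ˢ posPoly Λ) (v : symSeq (Λ.erase 0) × symSeq Λ) :
    ∀ᶠ τ : ℝ in 𝓝 0, x + τ • v ∈ posPolyOne Λ ×ˢ posPoly Λ := by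
  have h : ContinuousAt (fun τ : ℝ => x + τ • v) 0 := by fun_prop
  exact h.eventually ((isOpen_posPoly_prod Λ).mem_nhds (by simpa using hx))

theorem polyP_line {Λ : Finset (Fin d → ℤ)} (x v : symSeq (Λ.erase 0) × symSeq Λ) (τ : ℝ)
    (t : UnitAddTorus (Fin d)) :
    polyP (x + τ • v).1 t = polyP x.1 t + τ * trigPoly v.1 t := by
  simp only [polyP, Prod.fst_add, Prod.smul_fst, trigPoly_add, trigPoly_smul]
  ring

theorem trigPoly_line {Λ : Finset (Fin d → ℤ)} (x v : symSeq (Λ.erase 0) × symSeq Λ) (τ : ℝ)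
    (t : UnitAddTorus (Fin d)) :
    trigPoly (x + τ • v).2 t = trigPoly x.2 t + τ * trigPoly v.2 t := by
  simp only [Prod.snd_add, Prod.smul_snd, trigPoly_add, trigPoly_smul]

theorem symm_erase {Λ : Finset (Fin d → ℤ)} (hsymm : ∀ k ∈ Λ, -k ∈ Λ) :
    ∀ k ∈ Λ.erase 0, -k ∈ Λ.erase 0 := by
  simp only [Finset.mem_erase, ne_eq, neg_eq_zero]
  exact fun k hk => ⟨hk.1, hsymm k hk.2⟩

/-- A continuous nonnegative function with zero integral vanishes. -/
theorem eq_zero_of_integral_eq_zero {f : UnitAddTorus (Fin d) → ℝ} (hf : Continuous f)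
    (h0 : ∀ t, 0 ≤ f t) (hint : ∫ t, f t ∂torusMeasure d = 0) (t : UnitAddTorus (Fin d)) :
    f t = 0 := by
  rw [integral_eq_zero_iff_of_nonneg h0 (integrable_of_continuous hf)] at hint
  exact congrFun ((hf.ae_eq_iff_eq (torusMeasure d) continuous_zero).1 hint) t

/-- For fixed `λ` the differential is the Hessian of the dual function. Pairing a kernel vector with
its image gives the integral of two squares with positive weights: the one carrying `λ` forces the
variation of `P` to vanish, and then the other forces that of `Q` to vanish. -/
theorem fderiv_extMomentMap_injective {Λ : Finset (Fin d → ℤ)} (hsymm : ∀ k ∈ Λ, -k ∈ Λ) (n : ℕ)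
    {x : symSeq (Λ.erase 0) × symSeq Λ} (hx : x ∈ posPolyOne Λ ×ˢ posPoly Λ) {l : ℝ}
    (hl : 0 < l) : Function.Injective (fderiv ℝ (extMomentMap Λ (n + 2)) (x, l)) := by
  rw [injective_iff_map_eq_zero]
  rintro ⟨v, s⟩ hv
  have hr : DifferentiableAt ℝ (fun z : (symSeq (Λ.erase 0) × symSeq Λ) × ℝ =>
      ratioMap Λ z.1 ^ (n + 2)) (x, l) :=
    ((ContDiffAt.comp (x, l) (g := ratioMap Λ) (contDiffAt_ratioMap hx)
      contDiffAt_fst).pow (n + 2)).differentiableAt (by simp)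
  have hc : DifferentiableAt ℝ (cepstralMap Λ (n + 2)) (x, l) :=
    (contDiffAt_cepstralMap (n + 2) hx l).differentiableAt (by simp)
  have hr' := hr.hasFDerivAt
  have hc' := hc.hasFDerivAt
  set R := fderiv ℝ (fun z : (symSeq (Λ.erase 0) × symSeq Λ) × ℝ =>
      ratioMap Λ z.1 ^ (n + 2)) (x, l)
  set S := fderiv ℝ (cepstralMap Λ (n + 2)) (x, l)
  have hD := (((((gamCLM Λ).hasFDerivAt.comp (x, l) hr').neg.prodMk
    ((gamCLM (Λ.erase 0)).hasFDerivAt.comp (x, l) hc')).prodMk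
    (hasFDerivAt_snd (𝕜 := ℝ) (p := (x, l)))).congr_of_eventuallyEq
      (extMomentMap_eventuallyEq (n + 2) hx l)).fderiv
  rw [hD] at hv
  obtain ⟨⟨h1, h2⟩, h3⟩ : (-gamCLM Λ (R (v, s)) = 0 ∧ gamCLM (Λ.erase 0) (S (v, s)) = 0) ∧
      s = 0 := by
    simpa using! hv
  subst h3
  have hR : ∀ t, R (v, 0) t = (n + 2) * (polyP x.1 t / trigPoly x.2 t) ^ (n + 1) *
      ((trigPoly v.1 t - polyP x.1 t / trigPoly x.2 t * trigPoly v.2 t) / trigPoly x.2 t) := by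
    intro t
    have h := hasDerivAt_ratio_pow (polyP x.1 t) (trigPoly v.1 t) (hx.2 t).ne' (trigPoly v.2 t)
      (n + 1)
    refine (hasFDerivAt_apply_eq hr' (v, 0) h ?_).trans (by push_cast; ring)
    filter_upwards [eventually_mem_line hx v] with τ hτ
    simp only [Prod.fst_add, Prod.smul_mk, ContinuousMap.pow_apply]
    rw [ratioMap_apply hτ, polyP_line, trigPoly_line]
  have hS : ∀ t, S (v, 0) t = (n + 2) * (polyP x.1 t / trigPoly x.2 t) ^ n *
      ((trigPoly v.1 t - polyP x.1 t / trigPoly x.2 t * trigPoly v.2 t) / trigPoly x.2 t) +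
      l * (n + 2) * trigPoly v.1 t / polyP x.1 t ^ (n + 3) := by
    intro t
    refine hasFDerivAt_apply_eq hc' (v, 0) (hasDerivAt_cepstral (hx.1 t).ne' (hx.2 t).ne'
      (trigPoly v.1 t) (trigPoly v.2 t) l n) ?_
    filter_upwards [eventually_mem_line hx v] with τ hτ
    simp only [Prod.mk_add_mk, Prod.smul_mk, smul_zero, add_zero]
    rw [cepstralMap_apply _ hτ, polyP_line, trigPoly_line]
    push_cast
    ring_nf
  have hpair : ∫ t, (trigPoly v.1 t * S (v, 0) t - trigPoly v.2 t * R (v, 0) t)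
      ∂torusMeasure d = 0 := by
    rw [integral_sub, ← sum_mul_gamCLM, ← sum_mul_gamCLM, h2, neg_eq_zero.1 h1]
    · simp
    · exact integrable_of_continuous ((continuous_trigPoly _).mul (map_continuous _))
    · exact integrable_of_continuous ((continuous_trigPoly _).mul (map_continuous _))
  have hform : ∀ t, trigPoly v.1 t * S (v, 0) t - trigPoly v.2 t * R (v, 0) t =
      (n + 2) * (polyP x.1 t / trigPoly x.2 t) ^ n / trigPoly x.2 t *
        (trigPoly v.1 t - polyP x.1 t / trigPoly x.2 t * trigPoly v.2 t) ^ 2 +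
      l * (n + 2) / polyP x.1 t ^ (n + 3) * trigPoly v.1 t ^ 2 := by
    intro t
    rw [hR, hS]
    ring
  have hpos : ∀ t, 0 < (n + 2) * (polyP x.1 t / trigPoly x.2 t) ^ n / trigPoly x.2 t ∧
      0 < l * (n + 2) / polyP x.1 t ^ (n + 3) := fun t => by
    have := hx.1 t
    have := hx.2 t
    constructor <;> positivity
  have hzero := eq_zero_of_integral_eq_zero
    (f := fun t => trigPoly v.1 t * S (v, 0) t - trigPoly v.2 t * R (v, 0) t)
    (((continuous_trigPoly _).mul (map_continuous _)).sub
      ((continuous_trigPoly _).mul (map_continuous _))) (fun t => by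
        rw [hform]
        have := hpos t
        exact add_nonneg (mul_nonneg this.1.le (sq_nonneg _))
          (mul_nonneg this.2.le (sq_nonneg _))) hpair
  have hv1 : ∀ t, trigPoly v.1 t = 0 := fun t => by
    have h := hzero t
    rw [hform] at h
    obtain ⟨ha, hb⟩ := hpos t
    have := (add_eq_zero_iff_of_nonneg (mul_nonneg ha.le (sq_nonneg _))
      (mul_nonneg hb.le (sq_nonneg _))).1 h
    simpa [hb.ne'] using this.2
  have hv2 : ∀ t, trigPoly v.2 t = 0 := fun t => by
    have h := hzero t
    rw [hform, hv1] at h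
    obtain ⟨ha, hb⟩ := hpos t
    simpa [ha.ne', (hx.1 t).ne', (hx.2 t).ne'] using h
  have e1 := eq_zero_of_trigPoly_eq_zero (symm_erase hsymm) hv1
  have e2 := eq_zero_of_trigPoly_eq_zero hsymm hv2
  exact Prod.ext (Prod.ext e1 e2) rfl

/-! ### Monotonicity of the gradient and injectivity. -/

/-- The power function lies above its tangent at `s`: this is Bernoulli's inequality for `r / s`,
scaled. -/
theorem pow_tangent_nonneg {r s : ℝ} (hr : 0 < r) (hs : 0 < s) (n : ℕ) :
    0 ≤ r ^ (n + 2) - (n + 2) * s ^ (n + 1) * r + (n + 1) * s ^ (n + 2) := by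
  have h := one_add_mul_sub_le_pow (a := r / s) (by have : 0 < r / s := by positivity
                                                    linarith) (n + 2)
  have h2 := mul_le_mul_of_nonneg_right h (pow_pos hs (n + 2)).le
  rw [div_pow, div_mul_cancel₀ _ (pow_pos hs _).ne'] at h2
  push_cast at h2
  have h3 : (1 + ((n : ℝ) + 2) * (r / s - 1)) * s ^ (n + 2) =
      (n + 2) * s ^ (n + 1) * r - (n + 1) * s ^ (n + 2) := by
    field_simp
    ring
  linarith

theorem inv_pow_antitone_mul {a b : ℝ} (ha : 0 < a) (hb : 0 < b) (n : ℕ) :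
    (a - b) * (1 / a ^ (n + 1) - 1 / b ^ (n + 1)) ≤ 0 ∧
      ((a - b) * (1 / a ^ (n + 1) - 1 / b ^ (n + 1)) = 0 → a = b) := by
  rcases lt_trichotomy a b with h | h | h
  · have := one_div_lt_one_div_of_lt (pow_pos ha (n + 1)) (pow_lt_pow_left₀ h ha.le (by omega))
    have h1 := mul_neg_of_neg_of_pos (sub_neg.2 h) (sub_pos.2 this)
    exact ⟨h1.le, fun h2 => absurd h2 h1.ne⟩
  · simp [h]
  · have := one_div_lt_one_div_of_lt (pow_pos hb (n + 1)) (pow_lt_pow_left₀ h hb.le (by omega))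
    have h1 := mul_neg_of_pos_of_neg (sub_pos.2 h) (sub_neg.2 this)
    exact ⟨h1.le, fun h2 => absurd h2 h1.ne⟩

/-- Writing `a = (a / b) b`, the expression splits into the two tangent gaps between the ratios,
weighted by `b₁` and `b₂`. -/
theorem perspective_monotone {a₁ a₂ b₁ b₂ : ℝ} (ha₁ : 0 < a₁) (ha₂ : 0 < a₂)
    (hb₁ : 0 < b₁) (hb₂ : 0 < b₂) (n : ℕ) :
    0 ≤ (a₁ - a₂) * ((n + 2 : ℝ) / (n + 1) * (a₁ / b₁) ^ (n + 1) -
        (n + 2 : ℝ) / (n + 1) * (a₂ / b₂) ^ (n + 1)) -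
      (b₁ - b₂) * ((a₁ / b₁) ^ (n + 2) - (a₂ / b₂) ^ (n + 2)) := by
  obtain ⟨r, hr⟩ : ∃ r, r = a₁ / b₁ := ⟨_, rfl⟩
  obtain ⟨s, hs⟩ : ∃ s, s = a₂ / b₂ := ⟨_, rfl⟩
  have hr0 : 0 < r := by rw [hr]; positivity
  have hs0 : 0 < s := by rw [hs]; positivity
  rw [← hr, ← hs]
  have e1 : a₁ = r * b₁ := by rw [hr]; field_simp
  have e2 : a₂ = s * b₂ := by rw [hs]; field_simp
  have key : (a₁ - a₂) * ((n + 2 : ℝ) / (n + 1) * r ^ (n + 1) -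
        (n + 2 : ℝ) / (n + 1) * s ^ (n + 1)) - (b₁ - b₂) * (r ^ (n + 2) - s ^ (n + 2)) =
      1 / (n + 1) * (b₁ * (r ^ (n + 2) - (n + 2) * s ^ (n + 1) * r + (n + 1) * s ^ (n + 2)) +
        b₂ * (s ^ (n + 2) - (n + 2) * r ^ (n + 1) * s + (n + 1) * r ^ (n + 2))) := by
    rw [e1, e2]
    field_simp
    ring
  rw [key]
  have h1 := pow_tangent_nonneg hr0 hs0 n
  have h2 := pow_tangent_nonneg hs0 hr0 n
  positivity

/-- The perspective part is blind to a common rescaling of `a` and `b`. The term in `l` supplies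
strictness in `a`; once the `a`'s agree, strict decrease of inverse powers separates the `b`'s. -/
theorem gradient_monotone {a₁ a₂ b₁ b₂ l : ℝ} (ha₁ : 0 < a₁) (ha₂ : 0 < a₂)
    (hb₁ : 0 < b₁) (hb₂ : 0 < b₂) (hl : 0 < l) (n : ℕ) {D : ℝ}
    (hD : D = (a₁ - a₂) * (((n + 2 : ℝ) / (n + 1) * (a₁ / b₁) ^ (n + 1) - l / a₁ ^ (n + 2)) -
        ((n + 2 : ℝ) / (n + 1) * (a₂ / b₂) ^ (n + 1) - l / a₂ ^ (n + 2))) -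
      (b₁ - b₂) * ((a₁ / b₁) ^ (n + 2) - (a₂ / b₂) ^ (n + 2))) :
    0 ≤ D ∧ (D = 0 → a₁ = a₂ ∧ b₁ = b₂) := by
  have h1 := perspective_monotone ha₁ ha₂ hb₁ hb₂ n
  obtain ⟨h2, h3⟩ := inv_pow_antitone_mul ha₁ ha₂ (n + 1)
  have hsplit : D = ((a₁ - a₂) * ((n + 2 : ℝ) / (n + 1) * (a₁ / b₁) ^ (n + 1) -
        (n + 2 : ℝ) / (n + 1) * (a₂ / b₂) ^ (n + 1)) -
      (b₁ - b₂) * ((a₁ / b₁) ^ (n + 2) - (a₂ / b₂) ^ (n + 2))) +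
      l * -((a₁ - a₂) * (1 / a₁ ^ (n + 2) - 1 / a₂ ^ (n + 2))) := by
    rw [hD]; ring
  have h4 : 0 ≤ l * -((a₁ - a₂) * (1 / a₁ ^ (n + 2) - 1 / a₂ ^ (n + 2))) :=
    mul_nonneg hl.le (neg_nonneg.2 h2)
  refine ⟨by rw [hsplit]; exact add_nonneg h1 h4, fun h => ?_⟩
  rw [hsplit, add_eq_zero_iff_of_nonneg h1 h4] at h
  have ha : a₁ = a₂ := h3 (by simpa [hl.ne'] using h.2)
  refine ⟨ha, ?_⟩
  subst ha
  have h5 := h.1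
  simp only [sub_self, zero_mul, zero_sub, neg_eq_zero] at h5
  refine (inv_pow_antitone_mul hb₁ hb₂ (n + 1)).2 ?_
  have e : (b₁ - b₂) * ((a₁ / b₁) ^ (n + 2) - (a₁ / b₂) ^ (n + 2)) =
      a₁ ^ (n + 2) * ((b₁ - b₂) * (1 / b₁ ^ (n + 1 + 1) - 1 / b₂ ^ (n + 1 + 1))) := by
    rw [div_pow, div_pow]; ring
  rw [e] at h5
  exact (mul_eq_zero.1 h5).resolve_left (pow_pos ha₁ _).ne'

/-- If two images agree, pairing their difference with that of the arguments gives a zero integral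
of a continuous function, nonnegative by `gradient_monotone`; its pointwise vanishing identifies the
polynomials. -/
theorem momentMap_injOn {Λ : Finset (Fin d → ℤ)} (hsymm : ∀ k ∈ Λ, -k ∈ Λ) (n : ℕ)
    {l : ℝ} (hl : 0 < l) :
    InjOn (fun x => momentMap Λ (n + 2) x l) (posPolyOne Λ ×ˢ posPoly Λ) := by
  intro x hx y hy hxy
  simp only [momentMap_eq (n + 2) hx, momentMap_eq (n + 2) hy, Prod.mk.injEq, neg_inj] at hxy
  obtain ⟨h1, h2⟩ := hxy
  set f : C(UnitAddTorus (Fin d), ℝ) := ratioMap Λ x ^ (n + 2) - ratioMap Λ y ^ (n + 2) with hf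
  set g : C(UnitAddTorus (Fin d), ℝ) := cepstralMap Λ (n + 2) (x, l) - cepstralMap Λ (n + 2) (y, l)
    with hg
  have hf0 : gamCLM Λ f = 0 := by rw [hf, map_sub, h1, sub_self]
  have hg0 : gamCLM (Λ.erase 0) g = 0 := by rw [hg, map_sub, h2, sub_self]
  have hpair : ∫ t, (trigPoly (x.1 - y.1) t * g t - trigPoly (x.2 - y.2) t * f t)
      ∂torusMeasure d = 0 := by
    rw [integral_sub, ← sum_mul_gamCLM, ← sum_mul_gamCLM, hf0, hg0]
    · simp
    · exact integrable_of_continuous ((continuous_trigPoly _).mul (map_continuous _))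
    · exact integrable_of_continuous ((continuous_trigPoly _).mul (map_continuous _))
  have hmono := fun t => gradient_monotone (hx.1 t) (hy.1 t) (hx.2 t) (hy.2 t) hl n
    (D := trigPoly (x.1 - y.1) t * g t - trigPoly (x.2 - y.2) t * f t) (by
      have e1 : trigPoly (x.1 - y.1) t = polyP x.1 t - polyP y.1 t := by
        rw [trigPoly_sub, polyP, polyP]; ring
      have e2 : ((n + 2 : ℕ) : ℝ) / (((n + 2 : ℕ) : ℝ) - 1) = (n + 2 : ℝ) / (n + 1) := by
        push_cast; ring
      rw [e1, trigPoly_sub, hf, hg, ContinuousMap.sub_apply, ContinuousMap.sub_apply,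
        ContinuousMap.pow_apply, ContinuousMap.pow_apply, ratioMap_apply hx, ratioMap_apply hy,
        cepstralMap_apply _ hx, cepstralMap_apply _ hy, e2]
      rfl)
  have hzero := eq_zero_of_integral_eq_zero
    (((continuous_trigPoly _).mul (map_continuous _)).sub
      ((continuous_trigPoly _).mul (map_continuous _))) (fun t => (hmono t).1) hpair
  have e1 : x.1 - y.1 = 0 := eq_zero_of_trigPoly_eq_zero (symm_erase hsymm) fun t => by
    have := ((hmono t).2 (hzero t)).1
    simp only [polyP] at this
    rw [trigPoly_sub]
    linarith
  have e2 : x.2 - y.2 = 0 := eq_zero_of_trigPoly_eq_zero hsymm fun t => by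
    rw [trigPoly_sub, ((hmono t).2 (hzero t)).2, sub_self]
  exact Prod.ext (sub_eq_zero.1 e1) (sub_eq_zero.1 e2)

/-! ### First-order optimality. -/

/-- The regularized dual function on the set of positive polynomials. -/
def dualReal (Λ : Finset (Fin d → ℤ)) (ν : ℕ) (l : ℝ) (c : symSeq Λ)
    (m : symSeq (Λ.erase 0)) (x : symSeq (Λ.erase 0) × symSeq Λ) : ℝ :=
  integralCLM d (energyMap Λ ν l x) + (∑ k : Λ, (x.2 : Λ → ℝ) k * (c : Λ → ℝ) k -
    ∑ k : Λ.erase 0, (x.1 : Λ.erase 0 → ℝ) k * (m : Λ.erase 0 → ℝ) k)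

theorem eq_zero_of_sum_mul_self {I : Finset (Fin d → ℤ)} {q : symSeq I}
    (h : ∑ k : I, (q : I → ℝ) k * (q : I → ℝ) k = 0) : q = 0 := by
  ext k
  rw [Finset.sum_eq_zero_iff_of_nonneg fun k _ => mul_self_nonneg _] at h
  exact mul_self_eq_zero.1 (h k (Finset.mem_univ k))

/-- A local minimizer of the dual function among positive polynomials solves the moment
equations. -/
theorem momentMap_eq_of_isLocalMin {Λ : Finset (Fin d → ℤ)} (n : ℕ) {l : ℝ} {c : symSeq Λ}
    {m : symSeq (Λ.erase 0)} {x : symSeq (Λ.erase 0) × symSeq Λ}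
    (hx : x ∈ posPolyOne Λ ×ˢ posPoly Λ) (hmin : IsLocalMin (dualReal Λ (n + 2) l c m) x) :
    momentMap Λ (n + 2) x l = (-c, m) := by
  have hE := ((contDiffAt_energyMap (n + 2) hx l).differentiableAt (by simp)).hasFDerivAt
  set E := fderiv ℝ (energyMap Λ (n + 2) l) x
  have key : ∀ v : symSeq (Λ.erase 0) × symSeq Λ,
      (∑ k, (v.1 : Λ.erase 0 → ℝ) k * (gamCLM (Λ.erase 0) (cepstralMap Λ (n + 2) (x, l)) - m :
        symSeq (Λ.erase 0)).1 k) +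
      ∑ k, (v.2 : Λ → ℝ) k * (c - gamCLM Λ (ratioMap Λ x ^ (n + 2)) : symSeq Λ).1 k = 0 := by
    intro v
    have hEv : ∀ t, E v t = trigPoly v.1 t * cepstralMap Λ (n + 2) (x, l) t -
        trigPoly v.2 t * (ratioMap Λ x ^ (n + 2)) t := by
      intro t
      have h := hasDerivAt_energy (hx.1 t).ne' (hx.2 t).ne' (trigPoly v.1 t) (trigPoly v.2 t) l n
      have e2 : ((n + 2 : ℕ) : ℝ) - 1 = n + 1 := by push_cast; ring
      refine (hasFDerivAt_apply_eq hE v h ?_).trans ?_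
      · filter_upwards [eventually_mem_line hx v] with τ hτ
        rw [energyMap_apply _ hτ, polyP_line, trigPoly_line, e2]
        rfl
      · rw [cepstralMap_apply _ hx, ContinuousMap.pow_apply, ratioMap_apply hx, e2]
        push_cast
        rfl
    have h1 : HasDerivAt (fun τ : ℝ => x + τ • v) v 0 := by
      simpa using ((hasDerivAt_id (0 : ℝ)).smul_const v).const_add x
    have h2 : HasDerivAt (fun τ : ℝ => integralCLM d (energyMap Λ (n + 2) l (x + τ • v)))
        (integralCLM d (E v)) 0 :=
      (integralCLM d).hasFDerivAt.comp_hasDerivAt (0 : ℝ)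
        (HasFDerivAt.comp_hasDerivAt (0 : ℝ) (l := energyMap Λ (n + 2) l) (by simpa using hE) h1)
    have h3 : HasDerivAt (fun τ : ℝ => dualReal Λ (n + 2) l c m (x + τ • v))
        (integralCLM d (E v) + (∑ k : Λ, (v.2 : Λ → ℝ) k * (c : Λ → ℝ) k -
          ∑ k : Λ.erase 0, (v.1 : Λ.erase 0 → ℝ) k * (m : Λ.erase 0 → ℝ) k)) 0 := by
      have lin : ∀ a b e : ℝ, HasDerivAt (fun τ : ℝ => (a + τ * b) * e) (b * e) 0 := by
        intro a b e
        simpa using (((hasDerivAt_id (0 : ℝ)).mul_const b).const_add a).mul_const e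
      refine h2.add (HasDerivAt.sub ?_ ?_)
      · exact HasDerivAt.fun_sum fun k _ => lin _ _ _
      · exact HasDerivAt.fun_sum fun k _ => lin _ _ _
    have h4 : IsLocalMin (fun τ : ℝ => dualReal Λ (n + 2) l c m (x + τ • v)) 0 := by
      have hcont : ContinuousAt (fun τ : ℝ => x + τ • v) 0 := by fun_prop
      have hmin' : IsLocalMin (dualReal Λ (n + 2) l c m) ((fun τ : ℝ => x + τ • v) 0) := by
        simpa using hmin
      exact hcont.eventually hmin'
    have h5 := h4.hasDerivAt_eq_zero h3
    have h6 : integralCLM d (E v) =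
        ∑ k, (v.1 : Λ.erase 0 → ℝ) k * (gamCLM (Λ.erase 0) (cepstralMap Λ (n + 2) (x, l))).1 k -
        ∑ k, (v.2 : Λ → ℝ) k * (gamCLM Λ (ratioMap Λ x ^ (n + 2))).1 k := by
      rw [sum_mul_gamCLM, sum_mul_gamCLM, ← integral_sub, integralCLM_apply]
      · simp only [hEv]
      · exact integrable_of_continuous ((continuous_trigPoly _).mul (map_continuous _))
      · exact integrable_of_continuous ((continuous_trigPoly _).mul (map_continuous _))
    rw [h6] at h5
    simp only [AddSubgroupClass.coe_sub, Pi.sub_apply, mul_sub, Finset.sum_sub_distrib]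
    linarith
  rw [momentMap_eq _ hx]
  -- Testing the first variation against the residuals themselves yields vanishing sums of squares.
  have k1 := key (gamCLM (Λ.erase 0) (cepstralMap Λ (n + 2) (x, l)) - m, 0)
  have k2 := key (0, c - gamCLM Λ (ratioMap Λ x ^ (n + 2)))
  simp only [ZeroMemClass.coe_zero, Pi.zero_apply, zero_mul, Finset.sum_const_zero, add_zero,
    zero_add] at k1 k2
  rw [← sub_eq_zero.1 (eq_zero_of_sum_mul_self k1), ← sub_eq_zero.1 (eq_zero_of_sum_mul_self k2)]

/-! ### Coercivity and compactness. -/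

theorem trigPoly_nonneg_of_mem_closure {Λ : Finset (Fin d → ℤ)} {q : symSeq Λ}
    (hq : q ∈ closure (posPoly Λ)) (t : UnitAddTorus (Fin d)) : 0 ≤ trigPoly q t :=
  closure_minimal (fun _ hp => (hp t).le)
    (isClosed_Ici.preimage (continuous_trigPoly_left (I := Λ) t)) hq

theorem polyP_nonneg_of_mem_closure {Λ : Finset (Fin d → ℤ)} {p : symSeq (Λ.erase 0)}
    (hp : p ∈ closure (posPolyOne Λ)) (t : UnitAddTorus (Fin d)) : 0 ≤ polyP p t :=
  closure_minimal (fun _ hp => (hp t).le)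
    (isClosed_Ici.preimage (continuous_polyP_left (Λ := Λ) t)) hp

theorem continuous_pairing {I : Finset (Fin d → ℤ)} (c : symSeq I) :
    Continuous fun q : symSeq I => ∑ k : I, (q : I → ℝ) k * (c : I → ℝ) k :=
  continuous_finsetSum _ fun k _ =>
    ((continuous_apply k).comp continuous_subtype_val).mul continuous_const

/-- Covariances are positive on nonzero nonnegative polynomials. -/
theorem pairing_pos {Λ : Finset (Fin d → ℤ)} (hsymm : ∀ k ∈ Λ, -k ∈ Λ) {c : symSeq Λ}
    (hc : c ∈ covSet Λ) {q : symSeq Λ} (hq : ∀ t, 0 ≤ trigPoly q t) (hq0 : q ≠ 0) :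
    0 < ∑ k : Λ, (q : Λ → ℝ) k * (c : Λ → ℝ) k := by
  obtain ⟨Φ, hint, hnn, ⟨t₀, r, hr, hball⟩, -, rfl⟩ := hc
  rw [sum_mul_Gam q hint]
  have hpn : ∀ t, 0 ≤ trigPoly q t * Φ t := fun t => mul_nonneg (hq t) (hnn t)
  refine lt_of_le_of_ne (integral_nonneg hpn) fun h => hq0 ?_
  obtain ⟨C, hC⟩ := isCompact_univ.exists_bound_of_continuousOn (continuous_trigPoly q).continuousOn
  have hi : Integrable (fun t => trigPoly q t * Φ t) (torusMeasure d) :=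
    hint.bdd_mul (c := C) (continuous_trigPoly q).aestronglyMeasurable
      (.of_forall fun t => hC t (mem_univ t))
  rw [eq_comm, integral_eq_zero_iff_of_nonneg hpn hi] at h
  refine eq_zero_of_trigPoly_eq_zero hsymm (trigPoly_eq_zero_of_isOpen
    (s := Metric.ball t₀ r) Metric.isOpen_ball ⟨t₀, Metric.mem_ball_self hr⟩ fun t ht => ?_)
  -- The part of the ball where `q` is nonzero is open, and null because the product with `Φ`
  -- vanishes almost everywhere; a Haar measure charges nonempty open sets.
  by_contra hne
  have hopen : IsOpen (Metric.ball t₀ r ∩ {t | trigPoly q t ≠ 0}) :=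
    Metric.isOpen_ball.inter (isOpen_ne_fun (continuous_trigPoly q) continuous_const)
  have hpos := hopen.measure_pos (torusMeasure d) ⟨t, ht, hne⟩
  refine hpos.ne' (measure_mono_null ?_ h)
  rintro s ⟨hs, hs0⟩ hzero
  exact mul_ne_zero hs0 (hball s hs).ne' hzero

/-- The constant is the minimum of the pairing over the unit sphere of the nonnegative cone, which
is compact; homogeneity does the rest. -/
theorem exists_coercive {Λ : Finset (Fin d → ℤ)} (hsymm : ∀ k ∈ Λ, -k ∈ Λ) {c : symSeq Λ}
    (hc : c ∈ covSet Λ) : ∃ ε > 0, ∀ q : symSeq Λ, (∀ t, 0 ≤ trigPoly q t) →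
      ε * ‖q‖ ≤ ∑ k : Λ, (q : Λ → ℝ) k * (c : Λ → ℝ) k := by
  let s : Set (symSeq Λ) := Metric.sphere 0 1 ∩ {q | ∀ t, 0 ≤ trigPoly q t}
  have hs : IsCompact s := by
    refine (isCompact_sphere 0 1).inter_right ?_
    simp only [ofPred_forall]
    exact isClosed_iInter fun t => isClosed_Ici.preimage (continuous_trigPoly_left (I := Λ) t)
  have hcont : Continuous fun q : symSeq Λ => ∑ k : Λ, (q : Λ → ℝ) k * (c : Λ → ℝ) k :=
    continuous_pairing c
  obtain ⟨ε, hε, hmin⟩ : ∃ ε > 0, ∀ q ∈ s, ε ≤ ∑ k : Λ, (q : Λ → ℝ) k * (c : Λ → ℝ) k := by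
    rcases s.eq_empty_or_nonempty with h | h
    · exact ⟨1, one_pos, by simp [h]⟩
    · obtain ⟨q₀, hq₀, hmin⟩ := hs.exists_isMinOn h hcont.continuousOn
      refine ⟨_, pairing_pos hsymm hc hq₀.2 ?_, fun q hq => hmin hq⟩
      rintro rfl
      simpa using hq₀.1
  refine ⟨ε, hε, fun q hq => ?_⟩
  rcases eq_or_ne q 0 with rfl | hq0
  · simp
  have hn : 0 < ‖q‖ := norm_pos_iff.2 hq0
  have h := hmin (‖q‖⁻¹ • q) ⟨by
    rw [mem_sphere_zero_iff_norm, norm_smul, norm_inv, norm_norm, inv_mul_cancel₀ hn.ne'], fun t => by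
    rw [trigPoly_smul]; exact mul_nonneg (inv_nonneg.2 hn.le) (hq t)⟩
  have e : ∑ k : Λ, ((‖q‖⁻¹ • q : symSeq Λ) : Λ → ℝ) k * (c : Λ → ℝ) k =
      ‖q‖⁻¹ * ∑ k : Λ, (q : Λ → ℝ) k * (c : Λ → ℝ) k := by
    simp [Finset.mul_sum, mul_assoc]
  rw [e] at h
  calc ε * ‖q‖ ≤ (‖q‖⁻¹ * ∑ k : Λ, (q : Λ → ℝ) k * (c : Λ → ℝ) k) * ‖q‖ := by gcongr
    _ = _ := by field_simp

/-- A nonnegative `P` has `L¹` norm equal to its mean, which is 1, and this dominates every Fourier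
coefficient. -/
theorem abs_coeff_le_one {Λ : Finset (Fin d → ℤ)} (hsymm : ∀ k ∈ Λ, -k ∈ Λ)
    {p : symSeq (Λ.erase 0)} (hp : ∀ t, 0 ≤ polyP p t) (k : Λ.erase 0) :
    |(p : Λ.erase 0 → ℝ) k| ≤ 1 := by
  have h1 := integral_mFourier_mul_trigPoly (symm_erase hsymm) p k
  rw [dif_pos k.2] at h1
  have h2 : ∫ t, UnitAddTorus.mFourier (k : Fin d → ℤ) t * (polyP p t : ℂ) ∂torusMeasure d =
      ((p : Λ.erase 0 → ℝ) k : ℂ) := by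
    have hc : Continuous fun t => (trigPoly p t : ℂ) :=
      Complex.continuous_ofReal.comp (continuous_trigPoly p)
    rw [← h1]
    simp only [polyP, Complex.ofReal_add, Complex.ofReal_one, mul_add, mul_one]
    rw [integral_add (integrable_of_continuous (by fun_prop))
      (integrable_of_continuous (by fun_prop)), integral_mFourier,
      if_neg (Finset.ne_of_mem_erase k.2), zero_add]
  have h3 : ∫ t, polyP p t ∂torusMeasure d = 1 := by
    have h0 := integral_mFourier_mul_trigPoly (symm_erase hsymm) p 0
    rw [dif_neg (by simp)] at h0
    simp only [UnitAddTorus.mFourier_zero, ContinuousMap.one_apply, one_mul] at h0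
    rw [integral_complex_ofReal, Complex.ofReal_eq_zero] at h0
    simp only [polyP]
    rw [integral_add (integrable_of_continuous continuous_const)
      (integrable_of_continuous (continuous_trigPoly p)), h0]
    simp
  calc |(p : Λ.erase 0 → ℝ) k| = ‖((p : Λ.erase 0 → ℝ) k : ℂ)‖ := by simp
    _ ≤ ∫ t, polyP p t ∂torusMeasure d := by
      rw [← h2]
      refine (norm_integral_le_integral_norm _).trans_eq (integral_congr_ae (.of_forall fun t => ?_))
      simp [norm_mFourier_apply, abs_of_nonneg (hp t)]
    _ = 1 := h3

theorem isCompact_closure_posPolyOne {Λ : Finset (Fin d → ℤ)} (hsymm : ∀ k ∈ Λ, -k ∈ Λ) :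
    IsCompact (closure (posPolyOne Λ)) := by
  refine (isCompact_closedBall (0 : symSeq (Λ.erase 0)) 1).of_isClosed_subset isClosed_closure
    fun p hp => ?_
  rw [mem_closedBall_zero_iff]
  exact (pi_norm_le_iff_of_nonneg zero_le_one).2 fun k =>
    abs_coeff_le_one hsymm (polyP_nonneg_of_mem_closure hp) k

/-! ### Boundary values and lower semicontinuity of the dual function. -/

/-- If `P` has a zero, the term in `l` diverges whatever `Q` does. Otherwise `Q` has a zero while
`P` is bounded below, and the first integral diverges. -/
theorem regDual_eq_top {Λ : Finset (Fin d → ℤ)} (hd : 0 < d) {n : ℕ} (hn : d ≤ 2 * (n + 1))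
    {l : ℝ} (hl : 0 < l) (c : symSeq Λ) (m : symSeq (Λ.erase 0))
    {x : symSeq (Λ.erase 0) × symSeq Λ}
    (hx : x ∈ closure (posPolyOne Λ) ×ˢ closure (posPoly Λ))
    (hxU : x ∉ posPolyOne Λ ×ˢ posPoly Λ) : regDual Λ (n + 2) l c m x = ⊤ := by
  have e : ((n + 2 : ℕ) : ℝ) - 1 = n + 1 := by push_cast; ring
  have hP := polyP_nonneg_of_mem_closure hx.1
  have hQ := trigPoly_nonneg_of_mem_closure hx.2
  have suff : ENNReal.ofReal (1 / (((n + 2 : ℕ) : ℝ) - 1)) *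
      ∫⁻ t, ENNReal.ofReal (polyP x.1 t) ^ (n + 2) / ENNReal.ofReal (trigPoly x.2 t) ^ (n + 1)
        ∂torusMeasure d +
    ENNReal.ofReal (l / (((n + 2 : ℕ) : ℝ) - 1)) *
      ∫⁻ t, 1 / ENNReal.ofReal (polyP x.1 t) ^ (n + 1) ∂torusMeasure d = ⊤ := by
    rw [e]
    by_cases hp : x.1 ∈ posPolyOne Λ
    · have hq : x.2 ∉ posPoly Λ := fun h => hxU ⟨hp, h⟩
      obtain ⟨t₀, ht₀⟩ : ∃ t₀, trigPoly x.2 t₀ ≤ 0 := by simpa [posPoly] using hq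
      obtain ⟨C, hC, hb⟩ := exists_quadratic_bound x.2 0 (by simpa using hQ) (t₀ := t₀)
        (by linarith [hQ t₀])
      simp only [zero_add] at hb
      have hdiv := lintegral_inv_pow_eq_top hC hb hd hn
      obtain ⟨t₁, -, ht₁⟩ := isCompact_univ.exists_isMinOn univ_nonempty
        (continuous_polyP x.1).continuousOn
      have hδ : ENNReal.ofReal (polyP x.1 t₁) ^ (n + 2) ≠ 0 :=
        pow_ne_zero _ (by simpa using hp t₁)
      have hbig : ∫⁻ t, ENNReal.ofReal (polyP x.1 t) ^ (n + 2) /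
          ENNReal.ofReal (trigPoly x.2 t) ^ (n + 1) ∂torusMeasure d = ⊤ := by
        rw [← top_le_iff, ← ENNReal.mul_top hδ, ← hdiv, ← lintegral_const_mul' _ _ (by simp)]
        refine lintegral_mono fun t => ?_
        rw [div_eq_mul_inv]
        gcongr
        exact ht₁ (mem_univ t)
      rw [hbig, ENNReal.mul_top (by simpa using by positivity), top_add]
    · obtain ⟨t₀, ht₀⟩ : ∃ t₀, polyP x.1 t₀ ≤ 0 := by simpa [posPolyOne] using hp
      obtain ⟨C, hC, hb⟩ := exists_quadratic_bound x.1 1 hP (t₀ := t₀)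
        (le_antisymm ht₀ (hP t₀))
      have hdiv := lintegral_inv_pow_eq_top hC hb hd hn
      have hbig : ∫⁻ t, 1 / ENNReal.ofReal (polyP x.1 t) ^ (n + 1) ∂torusMeasure d = ⊤ := by
        simp only [one_div]
        exact hdiv
      rw [hbig, ENNReal.mul_top (by simpa using by positivity), add_top]
  unfold regDual
  rw [show n + 2 - 1 = n + 1 from rfl, suff]
  exact EReal.top_add_coe _

theorem regDual_eq_dualReal {Λ : Finset (Fin d → ℤ)} (n : ℕ) {l : ℝ} (hl : 0 < l)
    (c : symSeq Λ) (m : symSeq (Λ.erase 0)) {x : symSeq (Λ.erase 0) × symSeq Λ}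
    (hx : x ∈ posPolyOne Λ ×ˢ posPoly Λ) :
    regDual Λ (n + 2) l c m x = (dualReal Λ (n + 2) l c m x : EReal) := by
  have hP := hx.1
  have hQ := hx.2
  have e : ((n + 2 : ℕ) : ℝ) - 1 = n + 1 := by push_cast; ring
  have c1 : Continuous fun t => polyP x.1 t ^ (n + 2) / trigPoly x.2 t ^ (n + 1) :=
    ((continuous_polyP x.1).pow _).div₀ ((continuous_trigPoly x.2).pow _)
      fun t => (pow_pos (hQ t) _).ne'
  have c2 : Continuous fun t => 1 / polyP x.1 t ^ (n + 1) :=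
    continuous_const.div₀ ((continuous_polyP x.1).pow _) fun t => (pow_pos (hP t) _).ne'
  have p1 : ∀ t, 0 ≤ polyP x.1 t ^ (n + 2) / trigPoly x.2 t ^ (n + 1) := fun t => by
    have := hP t
    have := hQ t
    positivity
  have p2 : ∀ t, 0 ≤ 1 / polyP x.1 t ^ (n + 1) := fun t => by
    have := hP t
    positivity
  have h1 : ∫⁻ t, ENNReal.ofReal (polyP x.1 t) ^ (n + 2) /
      ENNReal.ofReal (trigPoly x.2 t) ^ (n + 1) ∂torusMeasure d =
      ENNReal.ofReal (∫ t, polyP x.1 t ^ (n + 2) / trigPoly x.2 t ^ (n + 1) ∂torusMeasure d) := by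
    rw [ofReal_integral_eq_lintegral_ofReal (integrable_of_continuous c1) (.of_forall p1)]
    refine lintegral_congr fun t => ?_
    rw [ENNReal.ofReal_div_of_pos (pow_pos (hQ t) _), ENNReal.ofReal_pow (hP t).le,
      ENNReal.ofReal_pow (hQ t).le]
  have h2 : ∫⁻ t, 1 / ENNReal.ofReal (polyP x.1 t) ^ (n + 1) ∂torusMeasure d =
      ENNReal.ofReal (∫ t, 1 / polyP x.1 t ^ (n + 1) ∂torusMeasure d) := by
    rw [ofReal_integral_eq_lintegral_ofReal (integrable_of_continuous c2) (.of_forall p2)]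
    refine lintegral_congr fun t => ?_
    rw [ENNReal.ofReal_div_of_pos (pow_pos (hP t) _), ENNReal.ofReal_pow (hP t).le,
      ENNReal.ofReal_one]
  have i1 : 0 ≤ ∫ t, polyP x.1 t ^ (n + 2) / trigPoly x.2 t ^ (n + 1) ∂torusMeasure d :=
    integral_nonneg p1
  have i2 : 0 ≤ ∫ t, 1 / polyP x.1 t ^ (n + 1) ∂torusMeasure d := integral_nonneg p2
  unfold regDual dualReal
  rw [show n + 2 - 1 = n + 1 from rfl, h1, h2, e, ← ENNReal.ofReal_mul (by positivity),
    ← ENNReal.ofReal_mul (by positivity), ← ENNReal.ofReal_add (by positivity) (by positivity),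
    EReal.coe_ennreal_ofReal, max_eq_left (by positivity), ← EReal.coe_add]
  congr 2
  rw [integralCLM_apply]
  simp only [energyMap_apply _ hx, show n + 2 - 1 = n + 1 from rfl, e]
  rw [integral_add ((integrable_of_continuous c1).const_mul _)
    ((integrable_of_continuous c2).const_mul _), integral_const_mul, integral_const_mul]

/-- Fatou's lemma as lower semicontinuity in a parameter. -/
theorem lowerSemicontinuous_lintegral {X T : Type*} [TopologicalSpace X]
    [FirstCountableTopology X] [MeasurableSpace T] {μ : Measure T} {f : X → T → ℝ≥0∞}
    (hm : ∀ x, Measurable (f x)) (hf : ∀ t, LowerSemicontinuous fun x => f x t) :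
    LowerSemicontinuous fun x => ∫⁻ t, f x t ∂μ := by
  intro x
  refine lowerSemicontinuousAt_iff_le_liminf.2 ?_
  refine (lintegral_mono fun t => ?_).trans (lintegral_liminf_le hm)
  exact lowerSemicontinuousAt_iff_le_liminf.1 (hf t x)

/-- Division is continuous away from `0 / 0`. Where the numerator vanishes (its exponent is
positive) the quotient takes the minimal value 0, even over 0. -/
theorem lowerSemicontinuous_pow_div_pow {X : Type*} [TopologicalSpace X] {f g : X → ℝ}
    (hf : Continuous f) (hg : Continuous g) (i j : ℕ) :
    LowerSemicontinuous fun x => ENNReal.ofReal (f x) ^ (i + 1) / ENNReal.ofReal (g x) ^ j := by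
  intro x
  by_cases h : ENNReal.ofReal (f x) = 0
  · intro y hy
    simp [h] at hy
  · refine ContinuousAt.lowerSemicontinuousAt ?_
    have h1 : ContinuousAt (fun x => ENNReal.ofReal (f x) ^ (i + 1)) x :=
      ((ENNReal.continuous_pow _).comp (ENNReal.continuous_ofReal.comp hf)).continuousAt
    have h2 : ContinuousAt (fun x => ENNReal.ofReal (g x) ^ j) x :=
      ((ENNReal.continuous_pow _).comp (ENNReal.continuous_ofReal.comp hg)).continuousAt
    exact ENNReal.Tendsto.div h1 (.inl (pow_ne_zero _ h)) h2
      (.inr (ENNReal.pow_ne_top ENNReal.ofReal_ne_top))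

theorem lowerSemicontinuous_regDual {Λ : Finset (Fin d → ℤ)} (n : ℕ) (l : ℝ) (c : symSeq Λ)
    (m : symSeq (Λ.erase 0)) : LowerSemicontinuous (regDual Λ (n + 2) l c m) := by
  have h1 : LowerSemicontinuous fun x : symSeq (Λ.erase 0) × symSeq Λ =>
      ∫⁻ t, ENNReal.ofReal (polyP x.1 t) ^ (n + 2) / ENNReal.ofReal (trigPoly x.2 t) ^ (n + 1)
        ∂torusMeasure d := by
    refine lowerSemicontinuous_lintegral (fun x => ?_) fun t => ?_
    · have := (continuous_polyP x.1).measurable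
      have := (continuous_trigPoly x.2).measurable
      fun_prop
    · exact lowerSemicontinuous_pow_div_pow ((continuous_polyP_left t).comp continuous_fst)
        ((continuous_trigPoly_left t).comp continuous_snd) (n + 1) (n + 1)
  have h2 : LowerSemicontinuous fun x : symSeq (Λ.erase 0) × symSeq Λ =>
      ∫⁻ t, 1 / ENNReal.ofReal (polyP x.1 t) ^ (n + 1) ∂torusMeasure d := by
    refine lowerSemicontinuous_lintegral (fun x => ?_) fun t => ?_
    · have := (continuous_polyP x.1).measurable
      fun_prop
    · simpa using lowerSemicontinuous_pow_div_pow (continuous_const (y := (1 : ℝ)))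
        ((continuous_polyP_left t).comp continuous_fst) 0 (n + 1)
  have hmul : ∀ a : ℝ, ∀ f : symSeq (Λ.erase 0) × symSeq Λ → ℝ≥0∞, LowerSemicontinuous f →
      LowerSemicontinuous fun x => ENNReal.ofReal a * f x := fun a f hf =>
    (ENNReal.continuous_const_mul ENNReal.ofReal_ne_top).comp_lowerSemicontinuous hf
      fun _ _ h => mul_le_mul_right h _
  have h3 := continuous_coe_ennreal_ereal.comp_lowerSemicontinuous
    ((hmul (1 / (((n + 2 : ℕ) : ℝ) - 1)) _ h1).add (hmul (l / (((n + 2 : ℕ) : ℝ) - 1)) _ h2))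
    fun _ _ h => EReal.coe_ennreal_le_coe_ennreal_iff.2 h
  have h4 : Continuous fun x : symSeq (Λ.erase 0) × symSeq Λ =>
      ((∑ k : Λ, (x.2 : Λ → ℝ) k * (c : Λ → ℝ) k -
        ∑ k : Λ.erase 0, (x.1 : Λ.erase 0 → ℝ) k * (m : Λ.erase 0 → ℝ) k : ℝ) : EReal) :=
    continuous_coe_real_ereal.comp
      (((continuous_pairing c).comp continuous_snd).sub ((continuous_pairing m).comp continuous_fst))
  exact h3.add' h4.lowerSemicontinuous fun x =>
    EReal.continuousAt_add (.inr (EReal.coe_ne_bot _)) (.inr (EReal.coe_ne_top _))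

/-! ### Existence and interiority of minimizers. -/

theorem exists_mem_pos {Λ : Finset (Fin d → ℤ)} (h0 : (0 : Fin d → ℤ) ∈ Λ) :
    (posPolyOne Λ ×ˢ posPoly Λ).Nonempty := by
  let q : symSeq Λ := ⟨fun k => if (k : Fin d → ℤ) = 0 then 1 else 0, fun j k h => by simp [h]⟩
  refine ⟨(0, q), fun t => ?_, fun t => ?_⟩
  · simp [polyP, trigPoly_eq_sum]
  · rw [trigPoly_eq_sum, Finset.sum_eq_single ⟨0, h0⟩]
    · simp [q, cosChar_apply, UnitAddTorus.mFourier_zero]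
    · intro k _ hk
      have : (k : Fin d → ℤ) ≠ 0 := fun h => hk (Subtype.ext h)
      simp [q, this]
    · simp

theorem prod_subset_closure (Λ : Finset (Fin d → ℤ)) :
    posPolyOne Λ ×ˢ posPoly Λ ⊆ closure (posPolyOne Λ) ×ˢ closure (posPoly Λ) :=
  prod_mono subset_closure subset_closure

theorem exists_isDualSolution {Λ : Finset (Fin d → ℤ)} (h0 : (0 : Fin d → ℤ) ∈ Λ)
    (hsymm : ∀ k ∈ Λ, -k ∈ Λ) (n : ℕ) {l : ℝ} (hl : 0 < l) {c : symSeq Λ} (hc : c ∈ covSet Λ)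
    (m : symSeq (Λ.erase 0)) : ∃ x, IsDualSolution Λ (n + 2) l c m x := by
  obtain ⟨x₀, hx₀⟩ := exists_mem_pos h0
  obtain ⟨ε, hε, hcoer⟩ := exists_coercive hsymm hc
  set M : ℝ := ∑ k : Λ.erase 0, |(m : Λ.erase 0 → ℝ) k|
  set r₀ := dualReal Λ (n + 2) l c m x₀ with hr₀
  have hlow : ∀ x ∈ closure (posPolyOne Λ) ×ˢ closure (posPoly Λ),
      ((ε * ‖x.2‖ - M : ℝ) : EReal) ≤ regDual Λ (n + 2) l c m x := by
    intro x hx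
    have h1 := hcoer x.2 (trigPoly_nonneg_of_mem_closure hx.2)
    have h2 : ∑ k : Λ.erase 0, (x.1 : Λ.erase 0 → ℝ) k * (m : Λ.erase 0 → ℝ) k ≤ M := by
      refine Finset.sum_le_sum fun k _ => (le_abs_self _).trans ?_
      rw [abs_mul]
      exact mul_le_of_le_one_left (abs_nonneg _)
        (abs_coeff_le_one hsymm (polyP_nonneg_of_mem_closure hx.1) k)
    unfold regDual
    refine le_trans (EReal.coe_le_coe_iff.2 (sub_le_sub h1 h2)) ?_
    exact le_add_of_nonneg_left (EReal.coe_ennreal_nonneg _)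
  -- The first entry keeps the reference point `x₀` in the compact set; beyond the second, the lower
  -- bound `hlow` exceeds the value at `x₀`.
  set R := max ‖x₀.2‖ ((r₀ + M) / ε)
  let K := closure (posPolyOne Λ) ×ˢ (closure (posPoly Λ) ∩ Metric.closedBall 0 R)
  have hK : IsCompact K := (isCompact_closure_posPolyOne hsymm).prod
    ((isCompact_closedBall 0 R).inter_left isClosed_closure)
  have hx₀c := prod_subset_closure Λ hx₀
  have hx₀K : x₀ ∈ K := ⟨hx₀c.1, hx₀c.2, by simp [R]⟩
  obtain ⟨x, hxK, hmin⟩ := LowerSemicontinuousOn.exists_isMinOn ⟨x₀, hx₀K⟩ hK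
    ((lowerSemicontinuous_regDual n l c m).lowerSemicontinuousOn K)
  refine ⟨x, ⟨hxK.1, hxK.2.1⟩, fun y hy => ?_⟩
  by_cases hyR : ‖y.2‖ ≤ R
  · exact hmin ⟨hy.1, hy.2, by simpa using hyR⟩
  · have h1 : (r₀ + M) / ε < ‖y.2‖ := (le_max_right _ _).trans_lt (not_le.1 hyR)
    rw [div_lt_iff₀ hε] at h1
    calc regDual Λ (n + 2) l c m x ≤ regDual Λ (n + 2) l c m x₀ := hmin hx₀K
      _ = (r₀ : EReal) := regDual_eq_dualReal n hl c m hx₀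
      _ ≤ ((ε * ‖y.2‖ - M : ℝ) : EReal) := EReal.coe_le_coe_iff.2 (by linarith)
      _ ≤ _ := hlow y hy

theorem IsDualSolution.mem_and_momentMap_eq {Λ : Finset (Fin d → ℤ)} (h0 : (0 : Fin d → ℤ) ∈ Λ)
    (hd : 0 < d) {n : ℕ} (hn : d ≤ 2 * (n + 1)) {l : ℝ} (hl : 0 < l) {c : symSeq Λ}
    {m : symSeq (Λ.erase 0)} {x : symSeq (Λ.erase 0) × symSeq Λ}
    (hx : IsDualSolution Λ (n + 2) l c m x) :
    x ∈ posPolyOne Λ ×ˢ posPoly Λ ∧ momentMap Λ (n + 2) x l = (-c, m) := by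
  obtain ⟨x₀, hx₀⟩ := exists_mem_pos h0
  have hU : x ∈ posPolyOne Λ ×ˢ posPoly Λ := by
    by_contra h
    have h1 : regDual Λ (n + 2) l c m x ≤ regDual Λ (n + 2) l c m x₀ :=
      hx.2 (prod_subset_closure Λ hx₀)
    rw [regDual_eq_top hd hn hl c m hx.1 h, regDual_eq_dualReal n hl c m hx₀, top_le_iff] at h1
    exact EReal.coe_ne_top _ h1
  refine ⟨hU, momentMap_eq_of_isLocalMin n hU ?_⟩
  filter_upwards [(isOpen_posPoly_prod Λ).mem_nhds hU] with y hy
  have h1 : regDual Λ (n + 2) l c m x ≤ regDual Λ (n + 2) l c m y :=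
    hx.2 (prod_subset_closure Λ hy)
  rwa [regDual_eq_dualReal n hl c m hU, regDual_eq_dualReal n hl c m hy,
    EReal.coe_le_coe_iff] at h1

/-! ### Global inversion and conclusion. -/

/-- A smooth injective map with injective derivatives between spaces of the same finite dimension
is a diffeomorphism onto its image. -/
theorem isSmoothDiffeoOn_image {E F : Type*} [NormedAddCommGroup E] [NormedSpace ℝ E]
    [FiniteDimensional ℝ E] [NormedAddCommGroup F] [NormedSpace ℝ F] [FiniteDimensional ℝ F]
    (hEF : Module.finrank ℝ E = Module.finrank ℝ F) {f : E → F} {U : Set E} (hU : IsOpen U)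
    (hf : ∀ x ∈ U, ContDiffAt ℝ ∞ f x) (hinj : InjOn f U)
    (hder : ∀ x ∈ U, Function.Injective (fderiv ℝ f x)) : IsSmoothDiffeoOn f U (f '' U) := by
  have : CompleteSpace E := FiniteDimensional.complete ℝ E
  rcases U.eq_empty_or_nonempty with rfl | ⟨x₁, -⟩
  · exact ⟨hU, by simp, by simp, by simp [ContDiffOn],
      fun _ => 0, by simp [InvOn, LeftInvOn, RightInvOn], by simp [ContDiffOn]⟩
  have hne : Nonempty E := ⟨x₁⟩
  have hequiv : ∀ x ∈ U, ∃ f' : E ≃L[ℝ] F, HasFDerivAt f (f' : E →L[ℝ] F) x := fun x hx => by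
    let e := (LinearMap.linearEquivOfInjective (fderiv ℝ f x : E →ₗ[ℝ] F) (hder x hx)
      hEF).toContinuousLinearEquiv
    have he : (e : E →L[ℝ] F) = fderiv ℝ f x := by ext v; rfl
    exact ⟨e, he ▸ ((hf x hx).differentiableAt (by simp)).hasFDerivAt⟩
  have hopen : IsOpen (f '' U) := by
    rw [isOpen_iff_mem_nhds]
    rintro _ ⟨x, hx, rfl⟩
    obtain ⟨f', hf'⟩ := hequiv x hx
    rw [← ((hf x hx).hasStrictFDerivAt' hf' (by simp)).map_nhds_eq_of_equiv]
    exact image_mem_map (hU.mem_nhds hx)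
  refine ⟨hU, hopen, hinj.bijOn_image, fun x hx => (hf x hx).contDiffWithinAt,
    Function.invFunOn f U, hinj.bijOn_image.invOn_invFunOn, ?_⟩
  rintro _ ⟨x, hx, rfl⟩
  obtain ⟨f', hf'⟩ := hequiv x hx
  have hs := (hf x hx).hasStrictFDerivAt' hf' (by simp)
  -- By injectivity on `U`, the global inverse agrees near `f x` with the smooth local inverse.
  refine (((hf x hx).to_localInverse hf' (by simp)).congr_of_eventuallyEq ?_).contDiffWithinAt
  have hmem : ∀ᶠ y in 𝓝 (f x), hs.localInverse f f' x y ∈ U :=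
    hs.localInverse_tendsto.eventually (hU.mem_nhds hx)
  filter_upwards [hmem, hs.eventually_right_inverse] with y hy hfy
  change Function.invFunOn f U y = hs.localInverse f f' x y
  conv_lhs => rw [← hfy]
  exact hinj.leftInvOn_invFunOn hy

theorem neg_momentMap_mem_covSet {Λ : Finset (Fin d → ℤ)} (ν : ℕ)
    {x : symSeq (Λ.erase 0) × symSeq Λ} (hx : x ∈ posPolyOne Λ ×ˢ posPoly Λ) (l : ℝ) :
    -(momentMap Λ ν x l).1 ∈ covSet Λ := by
  have hpos : ∀ t, 0 < (polyP x.1 t / trigPoly x.2 t) ^ ν := fun t =>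
    pow_pos (div_pos (hx.1 t) (hx.2 t)) ν
  refine ⟨fun t => (polyP x.1 t / trigPoly x.2 t) ^ ν, integrable_of_continuous ?_,
    fun t => (hpos t).le, ⟨0, 1, one_pos, fun t _ => hpos t⟩, fun t => ?_, ?_⟩
  · exact ((continuous_polyP x.1).div₀ (continuous_trigPoly x.2) fun t => (hx.2 t).ne').pow ν
  · simp only [polyP_apply_neg, trigPoly_apply_neg]
  · simp only [momentMap, neg_neg]

/-- Surjectivity is variational: the minimizer for given data solves the equations with those data.
-/
theorem extMomentMap_image {Λ : Finset (Fin d → ℤ)} (h0 : (0 : Fin d → ℤ) ∈ Λ)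
    (hsymm : ∀ k ∈ Λ, -k ∈ Λ) (hd : 0 < d) {n : ℕ} (hn : d ≤ 2 * (n + 1)) :
    extMomentMap Λ (n + 2) '' ((posPolyOne Λ ×ˢ posPoly Λ) ×ˢ Ioi 0) =
      (((fun c => -c) '' covSet Λ) ×ˢ (univ : Set (symSeq (Λ.erase 0)))) ×ˢ Ioi 0 := by
  apply subset_antisymm
  · rintro _ ⟨⟨x, l⟩, ⟨hx, hl⟩, rfl⟩
    exact ⟨⟨⟨_, neg_momentMap_mem_covSet (n + 2) hx l, neg_neg _⟩, mem_univ _⟩, hl⟩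
  · rintro ⟨⟨_, m⟩, l⟩ ⟨⟨⟨c, hc, rfl⟩, -⟩, hl⟩
    obtain ⟨x, hx⟩ := exists_isDualSolution h0 hsymm n hl hc m
    obtain ⟨hxU, hxm⟩ := hx.mem_and_momentMap_eq h0 hd hn hl
    exact ⟨(x, l), ⟨hxU, hl⟩, by rw [extMomentMap, hxm]⟩

theorem isSmoothDiffeoOn_extMomentMap {Λ : Finset (Fin d → ℤ)} (h0 : (0 : Fin d → ℤ) ∈ Λ)
    (hsymm : ∀ k ∈ Λ, -k ∈ Λ) (hd : 0 < d) {n : ℕ} (hn : d ≤ 2 * (n + 1)) :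
    IsSmoothDiffeoOn (extMomentMap Λ (n + 2)) ((posPolyOne Λ ×ˢ posPoly Λ) ×ˢ Ioi 0)
      ((((fun c => -c) '' covSet Λ) ×ˢ (univ : Set (symSeq (Λ.erase 0)))) ×ˢ Ioi 0) := by
  rw [← extMomentMap_image h0 hsymm hd hn]
  refine isSmoothDiffeoOn_image ?_ ((isOpen_posPoly_prod Λ).prod isOpen_Ioi) ?_ ?_ ?_
  · exact ((LinearEquiv.prodComm ℝ _ _).prodCongr (LinearEquiv.refl ℝ ℝ)).finrank_eq
  · exact fun z hz => contDiffAt_extMomentMap (n + 2) hz.1 z.2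
  · rintro ⟨x, l⟩ hx ⟨y, l'⟩ hy hxy
    obtain ⟨h1, rfl⟩ : momentMap Λ (n + 2) x l = momentMap Λ (n + 2) y l' ∧ l = l' := by
      simpa [extMomentMap] using hxy
    exact congrArg (·, l) (momentMap_injOn hsymm n hx.2 hx.1 hy.1 h1)
  · exact fun z hz => fderiv_extMomentMap_injective hsymm n hz.1 hz.2

end

end CepstralMoment

open CepstralMoment in
theorem mainTheorem2 (d : ℕ) (hd : 0 < d) (Λ : Finset (Fin d → ℤ)) (h0 : (0 : Fin d → ℤ) ∈ Λ)
    (hsymm : ∀ k ∈ Λ, -k ∈ Λ) (ν : ℕ) (hν : (d : ℝ) / 2 + 1 ≤ (ν : ℝ)) :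
    -- for fixed `l`, the moment map is a smooth diffeomorphism
    (∀ l : ℝ, 0 < l →
      IsSmoothDiffeoOn (fun x => momentMap Λ ν x l) (posPolyOne Λ ×ˢ posPoly Λ)
        (((fun c => -c) '' covSet Λ) ×ˢ (Set.univ : Set (symSeq (Λ.erase 0))))) ∧
    -- for fixed data, the moment equations have a unique solution, which is smooth in `l`
    (∀ c ∈ covSet Λ, ∀ m : symSeq (Λ.erase 0),
      (∀ l : ℝ, 0 < l → ∃! x, x ∈ posPolyOne Λ ×ˢ posPoly Λ ∧ momentMap Λ ν x l = (-c, m)) ∧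
      ∀ sol : ℝ → symSeq (Λ.erase 0) × symSeq Λ,
        (∀ l : ℝ, 0 < l →
          sol l ∈ posPolyOne Λ ×ˢ posPoly Λ ∧ momentMap Λ ν (sol l) l = (-c, m)) →
        ContDiffOn ℝ ∞ sol (Set.Ioi 0)) ∧
    -- well-posedness of the regularized dual problem: the solution exists, is unique, solves the
    -- moment equations, and depends continuously on the data `(c, m)` and on `l`
    (∀ c ∈ covSet Λ, ∀ m : symSeq (Λ.erase 0), ∀ l : ℝ, 0 < l →
      (∃! x, IsDualSolution Λ ν l c m x) ∧
      ∀ x, IsDualSolution Λ ν l c m x ↔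
        x ∈ posPolyOne Λ ×ˢ posPoly Λ ∧ momentMap Λ ν x l = (-c, m)) ∧
    ∀ S : (symSeq Λ × symSeq (Λ.erase 0)) × ℝ → symSeq (Λ.erase 0) × symSeq Λ,
      (∀ c ∈ covSet Λ, ∀ m : symSeq (Λ.erase 0), ∀ l : ℝ, 0 < l →
        IsDualSolution Λ ν l c m (S ((c, m), l))) →
      ContinuousOn S
        ((covSet Λ ×ˢ (Set.univ : Set (symSeq (Λ.erase 0)))) ×ˢ Set.Ioi (0 : ℝ)) := by
  -- `d ≥ 1` forces `ν ≥ 3/2`, hence `ν ≥ 2`; the shift removes truncated subtraction from `ν - 1`.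
  obtain ⟨n, rfl⟩ : ∃ n, ν = n + 2 := by
    have h1 : (1 : ℝ) ≤ d := by exact_mod_cast hd
    have h2 : (1 : ℝ) < (ν : ℝ) := by linarith
    have h3 : 1 < ν := by exact_mod_cast h2
    exact ⟨ν - 2, by omega⟩
  have hn : d ≤ 2 * (n + 1) := by
    have : (d : ℝ) ≤ 2 * (n + 1) := by
      push_cast at hν
      linarith
    exact_mod_cast this
  obtain ⟨-, hVopen, -, -, G, hG, hGs⟩ := isSmoothDiffeoOn_extMomentMap h0 hsymm hd hn
  have hGeq : ∀ x ∈ posPolyOne Λ ×ˢ posPoly Λ, ∀ l : ℝ, 0 < l →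
      (G (momentMap Λ (n + 2) x l, l)).1 = x := fun x hx l hl => by
    have h := hG.1 (show (x, l) ∈ (posPolyOne Λ ×ˢ posPoly Λ) ×ˢ Set.Ioi (0 : ℝ) from ⟨hx, hl⟩)
    exact congrArg Prod.fst h
  have hex : ∀ c ∈ covSet Λ, ∀ m : symSeq (Λ.erase 0), ∀ l : ℝ, 0 < l →
      ∃ x, IsDualSolution Λ (n + 2) l c m x ∧ x ∈ posPolyOne Λ ×ˢ posPoly Λ ∧
        momentMap Λ (n + 2) x l = (-c, m) := fun c hc m l hl => by
    obtain ⟨x, hx⟩ := exists_isDualSolution h0 hsymm n hl hc m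
    exact ⟨x, hx, hx.mem_and_momentMap_eq h0 hd hn hl⟩
  have huniq : ∀ {l : ℝ}, 0 < l → ∀ {y : symSeq Λ × symSeq (Λ.erase 0)},
      ∀ x ∈ posPolyOne Λ ×ˢ posPoly Λ, ∀ x' ∈ posPolyOne Λ ×ˢ posPoly Λ,
      momentMap Λ (n + 2) x l = y → momentMap Λ (n + 2) x' l = y → x = x' :=
    fun hl _ x hx x' hx' h h' => momentMap_injOn hsymm n hl hx hx' (h.trans h'.symm)
  refine ⟨fun l hl => ?_, fun c hc m => ⟨fun l hl => ?_, fun sol hsol => ?_⟩,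
    fun c hc m l hl => ⟨?_, fun x => ⟨fun hx => hx.mem_and_momentMap_eq h0 hd hn hl, ?_⟩⟩,
    fun S hS => ?_⟩
  · have hmaps : Set.MapsTo (fun x => momentMap Λ (n + 2) x l) (posPolyOne Λ ×ˢ posPoly Λ)
        (((fun c => -c) '' covSet Λ) ×ˢ (Set.univ : Set (symSeq (Λ.erase 0)))) := fun x hx =>
      ⟨⟨_, neg_momentMap_mem_covSet (n + 2) hx l, neg_neg _⟩, Set.mem_univ _⟩
    have hsurj : Set.SurjOn (fun x => momentMap Λ (n + 2) x l) (posPolyOne Λ ×ˢ posPoly Λ)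
        (((fun c => -c) '' covSet Λ) ×ˢ (Set.univ : Set (symSeq (Λ.erase 0)))) := by
      rintro ⟨_, m⟩ ⟨⟨c, hc, rfl⟩, -⟩
      obtain ⟨x, -, hx, hxm⟩ := hex c hc m l hl
      exact ⟨x, hx, hxm⟩
    refine ⟨isOpen_posPoly_prod Λ, ?_, ⟨hmaps, momentMap_injOn hsymm n hl, hsurj⟩, ?_,
      fun y => (G (y, l)).1, ⟨fun x hx => hGeq x hx l hl, ?_⟩, ?_⟩
    · have h := hVopen.preimage (f := fun y => (y, l)) (by fun_prop)
      convert! h using 1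
      ext y
      simp [hl]
    · intro x hx
      have h := ContDiffAt.comp x (contDiffAt_extMomentMap (n + 2) hx l)
        (contDiffAt_id.prodMk contDiffAt_const)
      exact h.fst.contDiffWithinAt
    · intro y hy
      obtain ⟨x, hx, rfl⟩ := hsurj hy
      change momentMap Λ (n + 2) (G (momentMap Λ (n + 2) x l, l)).1 l = momentMap Λ (n + 2) x l
      rw [hGeq x hx l hl]
    · exact contDiff_fst.comp_contDiffOn (hGs.comp (contDiffOn_id.prodMk contDiffOn_const)
        fun y hy => ⟨hy, hl⟩)
  · obtain ⟨x, -, hx, hxm⟩ := hex c hc m l hl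
    exact ⟨x, ⟨hx, hxm⟩, fun x' hx' => huniq hl _ hx'.1 _ hx hx'.2 hxm⟩
  · have h : ContDiffOn ℝ ∞ (fun l : ℝ => (G ((-c, m), l)).1) (Set.Ioi 0) :=
      contDiff_fst.comp_contDiffOn (hGs.comp (contDiffOn_const.prodMk contDiffOn_id)
        fun l hl => ⟨⟨⟨c, hc, rfl⟩, Set.mem_univ _⟩, hl⟩)
    refine h.congr fun l hl => ?_
    obtain ⟨h1, h2⟩ := hsol l hl
    rw [← h2, hGeq _ h1 l hl]
  · obtain ⟨x, hxs, hx, hxm⟩ := hex c hc m l hl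
    refine ⟨x, hxs, fun x' hx' => ?_⟩
    obtain ⟨h1, h2⟩ := hx'.mem_and_momentMap_eq h0 hd hn hl
    exact huniq hl _ h1 _ hx h2 hxm
  -- A solution of the equations coincides with the existing minimizer by injectivity, so convexity
  -- of the dual function is not invoked.
  · rintro ⟨hx, hxm⟩
    obtain ⟨x', hxs, hx', hxm'⟩ := hex c hc m l hl
    rwa [huniq hl _ hx _ hx' hxm hxm']
  · have h : ContinuousOn (fun z : (symSeq Λ × symSeq (Λ.erase 0)) × ℝ =>
        (G ((-z.1.1, z.1.2), z.2)).1)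
        ((covSet Λ ×ˢ (Set.univ : Set (symSeq (Λ.erase 0)))) ×ˢ Set.Ioi (0 : ℝ)) := by
      refine continuous_fst.comp_continuousOn (hGs.continuousOn.comp (by fun_prop) fun z hz => ?_)
      exact ⟨⟨⟨z.1.1, hz.1.1, rfl⟩, Set.mem_univ _⟩, hz.2⟩
    refine h.congr fun z hz => ?_
    obtain ⟨h1, h2⟩ := (hS z.1.1 hz.1.1 z.1.2 z.2 hz.2).mem_and_momentMap_eq h0 hd hn hz.2
    have h3 := hGeq _ h1 z.2 hz.2
    rw [h2] at h3
    exact h3.symm
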